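/- For $n \ge 1$, let $\mathcal{G}_{2\times n}$ be the $2\times n$ grid graph: its vertices are $a_i, b_i$ for $1 \le i \le n$, and its edges are $a_ia_{i+1}$ and $b_ib_{i+1}$ for $1 \le i \le n-1$, and $a_jb_j$ for $1 \le j \le n$. For a finite graph $G$ and $k \ge 1$, the total $k$-cut complex $\Delta_k^t(G)$ is the simplicial complex on $V(G)$ in which $\sigma \subseteq V(G)$ is a face if and only if $V(G) \setminus \sigma$ contains an independent set of size $k$. Theorem. For all integers $2 \le k \le n$, (the geometric realization of) $\Delta_k^t(\mathcal{G}_{2\times n})$ is homotopy equivalent to a wedge of $\binom{n-1}{k-1}$ spheres of dimension $2n-2k$: $$\Delta_k^t(\mathcal{G}_{2\times n}) \simeq \bigvee_{\binom{n-1}{k-1}} \mathbb{S}^{2n-2k}.$$ -/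

import Mathlib

open scoped ContinuousMap

/-- The `2 × n` grid graph. The vertex `(0, i)` is `a_{i+1}`, the vertex `(1, i)` is `b_{i+1}`;
two vertices are adjacent if they are consecutive in a row, or if they are the two vertices
of a column. -/
def gridGraph2 (n : ℕ) : SimpleGraph (Fin 2 × Fin n) where
  Adj p q :=
    (p.1 = q.1 ∧ ((p.2 : ℕ) + 1 = (q.2 : ℕ) ∨ (q.2 : ℕ) + 1 = (p.2 : ℕ))) ∨
      (p.1 ≠ q.1 ∧ p.2 = q.2)
  symm := ⟨fun p q h => by
    rcases h with ⟨h1, h2⟩ | ⟨h1, h2⟩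
    · exact Or.inl ⟨h1.symm, h2.symm⟩
    · exact Or.inr ⟨h1.symm, h2.symm⟩⟩
  loopless := ⟨fun p h => by
    rcases h with ⟨_, h2 | h2⟩ | ⟨h1, _⟩
    · omega
    · omega
    · exact h1 rfl⟩

/-- The total `k`-cut complex of a graph `G` on a finite vertex set: a set `σ` of vertices is a
face iff its complement contains an independent set of size `k`. (Mathlib's simplicial complexes
list only the nonempty faces.) -/
def totalCutComplex {V : Type*} [Fintype V] [DecidableEq V] (G : SimpleGraph V) (k : ℕ) :
    PreAbstractSimplicialComplex V where
  faces := {σ | σ.Nonempty ∧ ∃ S : Finset V, S ⊆ σᶜ ∧ G.IsNIndepSet k S}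
  isRelLowerSet_faces := by
    rintro σ ⟨hσ, S, hS, hI⟩
    refine ⟨hσ, fun τ hτ hne => ⟨hne, S, hS.trans ?_, hI⟩⟩
    exact Finset.compl_subset_compl.mpr hτ

/-- The geometric realization of a simplicial complex `K` on a finite vertex set `V`, as a subset
of `V → ℝ` (and a space with the subspace topology): the points of the standard simplex, in
barycentric coordinates, whose support is a face of `K`. -/
def PreAbstractSimplicialComplex.realization {V : Type*} [Fintype V]
    (K : PreAbstractSimplicialComplex V) : Set (V → ℝ) :=
  {x | x ∈ stdSimplex ℝ V ∧ Finset.univ.filter (fun v => x v ≠ 0) ∈ K.faces}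

/-- The identifications made in a wedge: the base point `p i` of each summand is identified with
one additional point (which is the whole wedge if there are no summands). -/
inductive WedgeRel {ι : Type*} {X : ι → Type*} (p : ∀ i, X i) :
    Unit ⊕ (Σ i, X i) → Unit ⊕ (Σ i, X i) → Prop
  | glue (i : ι) : WedgeRel p (Sum.inl ()) (Sum.inr ⟨i, p i⟩)

/-- The wedge of the pointed spaces `(X i, p i)`, with the quotient topology of the disjoint
union. -/
def Wedge {ι : Type*} {X : ι → Type*} (p : ∀ i, X i) : Type _ :=
  Quot (WedgeRel p)

instance {ι : Type*} {X : ι → Type*} [∀ i, TopologicalSpace (X i)] (p : ∀ i, X i) :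
    TopologicalSpace (Wedge p) :=
  inferInstanceAs (TopologicalSpace (Quot (WedgeRel p)))

/-- The unit sphere `S^d` in `ℝ^(d+1)`. -/
abbrev UnitSphere (d : ℕ) : Type :=
  Metric.sphere (0 : EuclideanSpace ℝ (Fin (d + 1))) 1

/-- The base point `(1, 0, …, 0)` of `S^d`. -/
noncomputable def UnitSphere.base (d : ℕ) : UnitSphere d :=
  ⟨EuclideanSpace.single 0 1, by simp⟩

/-- A wedge of `N` spheres of dimension `d`. -/
abbrev WedgeOfSpheres (N d : ℕ) : Type :=
  Wedge (fun _ : Fin N => UnitSphere.base d)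

/-!
The homotopy type is found by matching the faces of the complex in pairs and collapsing, in the
manner of discrete Morse theory.

Read a face `σ` through its complement `w`, which must contain `k` independent vertices of the grid.
If some column before the last meets `w` in a single vertex, take the first such column, and toggle
the vertex next to that single vertex in the following column. The columns before it are empty
or full, so their rows may be swapped, and an independent set of `w` that uses the toggled vertex
can be rerouted through the single vertex (`insert_mem_gridCutFaces_of_split`): toggling maps faces
to faces. If there is no such column, toggle the last vertex of the first row. Then the only
faces that are not matched are those for which `w` consists of `k - 1` full columns and
the last vertex of the first row (`criticalFace_iff`). They have dimension `2n - 2k`, and there are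
`(n - 1).choose (k - 1)` of them.

The vertex to be toggled depends only on the columns to the left of it (`IsSequential`). This makes
the toggle an involution, and the matching acyclic: along gradient paths the sum of the column
indices strictly increases. So a family of matched pairs whose removal leaves a subcomplex can be
removed by elementary collapses (`IsSequential.nonempty_homotopyEquiv_of_matched`). As all critical
faces have the same dimension `d`, the complex collapses to the subcomplex `L` of the critical faces
and the pairs of dimension at most `d`, while `L` without the critical faces collapses to
a vertex. Finally a complex made from a contractible one by attaching `d`-simplices is a
wedge of `d`-spheres up to homotopy (`nonempty_homotopyEquiv_wedge`): the contractible subcomplex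
has the homotopy extension property (`extendsHomotopies_sdiff`) and may be crushed to a point
(`nonempty_homotopyEquiv_of_crush`), and each open simplex, being homeomorphic to a vector space,
becomes a sphere, its one-point compactification. The homotopies are given by explicit
formulas in barycentric coordinates.
-/

/-! ### Realizations of lower sets of faces -/

section Realization

variable {V : Type*}

/-- The geometric realization of a family `F` of finite sets of vertices, in barycentric
coordinates. The families used are lower sets that may contain the empty set, which is the support
of no point of the standard simplex and so contributes nothing. -/
def geomRealization [Fintype V] (F : Set (Finset V)) : Set (V → ℝ) :=
  {x | x ∈ stdSimplex ℝ V ∧ Finset.univ.filter (fun v => x v ≠ 0) ∈ F}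

theorem isClosed_geomRealization [Fintype V] {F : Set (Finset V)} (hF : IsLowerSet F) :
    IsClosed (geomRealization F) := by
  have h : geomRealization F =
      ⋃ σ ∈ F, (stdSimplex ℝ V ∩ ⋂ w ∈ {w | w ∉ σ}, {x : V → ℝ | x w = 0}) := by
    ext x
    simp only [geomRealization, Set.mem_ofPred_eq, Set.mem_iUnion, Set.mem_inter_iff,
      Set.mem_iInter, exists_prop]
    constructor
    · rintro ⟨hx, hs⟩
      exact ⟨_, hs, hx, fun w hw => by simpa using hw⟩
    · rintro ⟨σ, hσ, hx, hw⟩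
      refine ⟨hx, hF ?_ hσ⟩
      intro w hw'
      by_contra hc
      exact (Finset.mem_filter.1 hw').2 (hw w hc)
  rw [h]
  refine Set.Finite.isClosed_biUnion (Set.toFinite _) fun σ _ => ?_
  refine (isClosed_stdSimplex ℝ V).inter (isClosed_biInter fun w _ => ?_)
  exact isClosed_eq (continuous_apply w) continuous_const

theorem isCompact_geomRealization [Fintype V] {F : Set (Finset V)} (hF : IsLowerSet F) :
    IsCompact (geomRealization F) :=
  (isCompact_stdSimplex ℝ V).of_isClosed_subset (isClosed_geomRealization hF) fun _ hx => hx.1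

open Classical in
/-- The least barycentric coordinate of a point at the vertices of `σ`, with value `0` for the empty
face. On a complex it is positive exactly on the open star of `σ`. -/
noncomputable def minCoord (σ : Finset V) (x : V → ℝ) : ℝ :=
  if h : σ.Nonempty then σ.inf' h x else 0

theorem continuous_minCoord (σ : Finset V) : Continuous (minCoord σ) := by
  unfold minCoord
  split_ifs with h
  · exact Continuous.finset_inf'_apply h fun i _ => continuous_apply i
  · exact continuous_const

theorem minCoord_le {σ : Finset V} (x : V → ℝ) {u : V} (hu : u ∈ σ) : minCoord σ x ≤ x u := by
  have h : σ.Nonempty := ⟨u, hu⟩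
  simpa [minCoord, h] using ⟨u, hu, le_refl (x u)⟩

theorem exists_eq_minCoord {σ : Finset V} (hσ : σ.Nonempty) (x : V → ℝ) :
    ∃ u ∈ σ, x u = minCoord σ x := by
  obtain ⟨u, hu, h⟩ := Finset.exists_mem_eq_inf' hσ x
  exact ⟨u, hu, by simp [minCoord, hσ, h]⟩

theorem minCoord_nonneg (σ : Finset V) {x : V → ℝ} (hx : ∀ v, 0 ≤ x v) : 0 ≤ minCoord σ x := by
  by_cases h : σ.Nonempty
  · obtain ⟨u, -, hu⟩ := exists_eq_minCoord h x
    exact hu ▸ hx u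
  · simp [minCoord, h]

theorem minCoord_eq_zero [Fintype V] {σ : Finset V} {x : V → ℝ} (hx : ∀ v, 0 ≤ x v)
    (h : ¬ σ ⊆ Finset.univ.filter (fun v => x v ≠ 0)) : minCoord σ x = 0 := by
  obtain ⟨u, hu, hu'⟩ := Finset.not_subset.1 h
  have : x u = 0 := by simpa using hu'
  exact le_antisymm (this ▸ minCoord_le x hu) (minCoord_nonneg σ hx)

end Realization

/-! ### Elementary collapses -/

section Collapse

variable {V : Type*} [DecidableEq V]

/-- At time `t`, the deformation that pushes the pair of faces `σ`, `insert v σ` away from `σ`,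
moving mass from the vertices of `σ` to `v`. -/
noncomputable def collapseMap (σ : Finset V) (v : V) (t : ℝ) (x : V → ℝ) : V → ℝ := fun w =>
  x w + t * minCoord σ x * ((if w = v then (σ.card : ℝ) else 0) - if w ∈ σ then 1 else 0)

theorem continuous_collapseMap (σ : Finset V) (v : V) :
    Continuous fun p : ℝ × (V → ℝ) => collapseMap σ v p.1 p.2 := by
  refine continuous_pi fun w => ?_
  have := (continuous_minCoord σ).comp (continuous_snd (X := ℝ) (Y := V → ℝ))
  unfold collapseMap
  simp only [Function.comp_def] at this
  fun_prop

theorem collapseMap_of_minCoord_eq_zero [Fintype V] {σ : Finset V} {x : V → ℝ} (v : V) (t : ℝ)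
    (h : minCoord σ x = 0) : collapseMap σ v t x = x := by
  ext w
  simp [collapseMap, h]

theorem collapseMap_zero (σ : Finset V) (v : V) (x : V → ℝ) : collapseMap σ v 0 x = x := by
  ext w
  simp [collapseMap]

theorem collapseMap_mem_stdSimplex [Fintype V] {σ : Finset V} {v : V} (hv : v ∉ σ) {t : ℝ}
    (ht0 : 0 ≤ t) (ht1 : t ≤ 1) {x : V → ℝ} (hx : x ∈ stdSimplex ℝ V) :
    collapseMap σ v t x ∈ stdSimplex ℝ V := by
  have hm := minCoord_nonneg σ hx.1
  refine ⟨fun w => ?_, ?_⟩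
  · unfold collapseMap
    by_cases hw : w ∈ σ
    · have hwv : w ≠ v := fun h => hv (h ▸ hw)
      have := minCoord_le x hw
      simp only [hwv, hw, if_true, if_false]
      nlinarith
    · simp only [hw, if_false, sub_zero]
      have := hx.1 w
      split_ifs <;> positivity
  · unfold collapseMap
    rw [Finset.sum_add_distrib, ← Finset.mul_sum, Finset.sum_sub_distrib]
    simp [hx.2]

/-- Removing a free pair of faces does not change the homotopy type. -/
theorem nonempty_homotopyEquiv_of_free_pair [Fintype V] {F : Set (Finset V)} (hF : IsLowerSet F)
    {σ : Finset V} (hσ : σ.Nonempty) {v : V} (hv : v ∉ σ) (hτF : insert v σ ∈ F)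
    (hfree : ∀ η ∈ F, σ ⊆ η → η = σ ∨ η = insert v σ) :
    Nonempty (geomRealization F ≃ₕ geomRealization (F \ {σ, insert v σ})) := by
  have key : ∀ x ∈ geomRealization F, minCoord σ x ≠ 0 →
      Finset.univ.filter (fun v => x v ≠ 0) ⊆ insert v σ := by
    intro x hx hm
    have hsub : σ ⊆ Finset.univ.filter (fun v => x v ≠ 0) := by
      by_contra h
      exact hm (minCoord_eq_zero hx.1.1 h)
    rcases hfree _ hx.2 hsub with h | h
    · rw [h]; exact Finset.subset_insert _ _
    · exact h.le
  have supp : ∀ x ∈ geomRealization F, minCoord σ x ≠ 0 → ∀ t : ℝ,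
      Finset.univ.filter (fun w => collapseMap σ v t x w ≠ 0) ⊆ insert v σ := by
    intro x hx hm t w hw
    by_contra hc
    have hxw : x w = 0 := by
      by_contra h0
      exact hc (key x hx hm (by simpa using h0))
    simp only [Finset.mem_insert, not_or] at hc
    exact (Finset.mem_filter.1 hw).2 (by simp [collapseMap, hxw, hc.1, hc.2])
  have mem : ∀ x ∈ geomRealization F, ∀ t : ℝ, 0 ≤ t → t ≤ 1 →
      collapseMap σ v t x ∈ geomRealization F := by
    intro x hx t h0 h1
    refine ⟨collapseMap_mem_stdSimplex hv h0 h1 hx.1, ?_⟩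
    by_cases hm : minCoord σ x = 0
    · rw [collapseMap_of_minCoord_eq_zero v t hm]; exact hx.2
    · exact hF (supp x hx hm t) hτF
  have minz : ∀ x ∈ geomRealization (F \ {σ, insert v σ}), minCoord σ x = 0 := by
    intro x hx
    by_contra hm
    have hsub : σ ⊆ Finset.univ.filter (fun v => x v ≠ 0) := by
      by_contra h
      exact hm (minCoord_eq_zero hx.1.1 h)
    exact hx.2.2 (hfree _ hx.2.1 hsub)
  have mem1 : ∀ x ∈ geomRealization F,
      collapseMap σ v 1 x ∈ geomRealization (F \ {σ, insert v σ}) := by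
    intro x hx
    refine ⟨(mem x hx 1 zero_le_one le_rfl).1, (mem x hx 1 zero_le_one le_rfl).2, fun hc => ?_⟩
    -- the vertex of `σ` where the minimum is attained has left the support
    obtain ⟨u, hu, hux⟩ := exists_eq_minCoord hσ x
    have huv : u ≠ v := fun h => hv (h ▸ hu)
    have h0 : collapseMap σ v 1 x u = 0 := by simp [collapseMap, hu, huv, hux]
    have hmem : u ∈ Finset.univ.filter (fun w => collapseMap σ v 1 x w ≠ 0) := by
      rcases hc with hc | hc
      · rw [hc]; exact hu
      · rw [Set.mem_singleton_iff] at hc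
        rw [hc]; exact Finset.mem_insert_of_mem hu
    simp [h0] at hmem
  let r : C(geomRealization F, geomRealization (F \ {σ, insert v σ})) :=
    ⟨fun x => ⟨collapseMap σ v 1 x, mem1 x x.2⟩, Continuous.subtype_mk
      ((continuous_collapseMap σ v).comp (continuous_const.prodMk continuous_subtype_val)) _⟩
  let i : C(geomRealization (F \ {σ, insert v σ}), geomRealization F) :=
    ⟨fun x => ⟨x, x.2.1, x.2.2.1⟩, Continuous.subtype_mk continuous_subtype_val _⟩
  have hri : r.comp i = ContinuousMap.id _ := by
    ext x : 2
    exact collapseMap_of_minCoord_eq_zero v 1 (minz x x.2)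
  let H : (ContinuousMap.id (geomRealization F)).Homotopy (i.comp r) :=
    { toFun := fun p => ⟨collapseMap σ v p.1 p.2, mem p.2 p.2.2 p.1 p.1.2.1 p.1.2.2⟩
      continuous_toFun := Continuous.subtype_mk ((continuous_collapseMap σ v).comp
        ((continuous_subtype_val.comp continuous_fst).prodMk
          (continuous_subtype_val.comp continuous_snd))) _
      map_zero_left := fun x => Subtype.ext (collapseMap_zero σ v x)
      map_one_left := fun x => rfl }
  exact ⟨⟨r, i, ⟨H.symm⟩, hri ▸ ContinuousMap.Homotopic.refl _⟩⟩

end Collapse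

/-! ### Crushing a contractible subspace -/

section Crush

open scoped unitInterval

/-- The homotopies of a subspace `A`, moving inside the ambient space and starting at the inclusion,
extend to homotopies starting at the identity. This is the case of the homotopy extension
property that crushing `A` to a point calls for. -/
def ExtendsHomotopies {X : Type*} [TopologicalSpace X] (A : Set X) : Prop :=
  ∀ h : C(A × I, X), (∀ a, h (a, 0) = a) →
    ∃ H : C(X × I, X), (∀ x, H (x, 0) = x) ∧ ∀ (a : A) (t : I), H (a, t) = h (a, t)

/-- If `q` crushes the contractible subspace `A` to a point and is otherwise injective, the end of
an extension to `X` of a contraction of `A` factors through `q`, and gives a homotopy inverse. -/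
theorem nonempty_homotopyEquiv_of_crush {X Y : Type*} [TopologicalSpace X] [TopologicalSpace Y]
    [CompactSpace X] [T2Space Y] {A : Set X} [ContractibleSpace A] (hA : ExtendsHomotopies A)
    (q : C(X, Y)) (hq : Function.Surjective q)
    (hqA : ∀ x y, q x = q y ↔ x = y ∨ (x ∈ A ∧ y ∈ A)) : Nonempty (X ≃ₕ Y) := by
  obtain ⟨a₀, ⟨h⟩⟩ := id_nullhomotopic A
  obtain ⟨H, H0, HA⟩ := hA ⟨fun p => (h (p.2, p.1) : A), by fun_prop⟩ (by simp)
  simp only [ContinuousMap.coe_mk] at HA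
  have hqm : Topology.IsQuotientMap q := q.continuous.isClosedMap.isQuotientMap q.continuous hq
  have hqm' : Topology.IsQuotientMap (Prod.map q (id : I → I)) :=
    (q.continuous.prodMap continuous_id).isClosedMap.isQuotientMap
      (q.continuous.prodMap continuous_id) (hq.prodMap Function.surjective_id)
  let e : C(X, X) := H.comp ⟨fun x => (x, 1), by fun_prop⟩
  have he : ∀ x y, q x = q y → e x = e y := by
    intro x y hxy
    rcases (hqA x y).1 hxy with rfl | ⟨hx, hy⟩
    · rfl
    · change H (x, 1) = H (y, 1)
      rw [HA ⟨x, hx⟩, HA ⟨y, hy⟩]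
      simp
  let g : C(Y, X) := hqm.lift e (fun x y hxy => he x y hxy)
  have hg : g.comp q = e := hqm.lift_comp e _
  let K : C(X × I, Y) := q.comp H
  have hK : ∀ p p' : X × I, Prod.map q (id : I → I) p = Prod.map q id p' → K p = K p' := by
    rintro ⟨x, t⟩ ⟨y, t'⟩ hxy
    obtain ⟨h1, rfl⟩ := Prod.mk.inj hxy
    rcases (hqA x y).1 h1 with rfl | ⟨hx, hy⟩
    · rfl
    · refine (hqA _ _).2 (Or.inr ?_)
      constructor
      · exact HA ⟨x, hx⟩ t ▸ Subtype.coe_prop _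
      · exact HA ⟨y, hy⟩ t ▸ Subtype.coe_prop _
  let q' : C(X × I, Y × I) := ⟨Prod.map q id, q.continuous.prodMap continuous_id⟩
  let L : C(Y × I, Y) := Topology.IsQuotientMap.lift (f := q') hqm' K (fun p p' hp => hK p p' hp)
  have hL : ∀ x t, L (q x, t) = q (H (x, t)) := fun x t =>
    DFunLike.congr_fun (Topology.IsQuotientMap.lift_comp (f := q') hqm' K
      (fun p p' hp => hK p p' hp)) (x, t)
  refine ⟨⟨q, g, ⟨ContinuousMap.Homotopy.symm ?_⟩, ⟨ContinuousMap.Homotopy.symm ?_⟩⟩⟩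
  · exact
      { toFun := fun p => H (p.2, p.1)
        continuous_toFun := by fun_prop
        map_zero_left := fun x => H0 x
        map_one_left := fun x => (DFunLike.congr_fun hg x).symm }
  · exact
      { toFun := fun p => L (p.2, p.1)
        continuous_toFun := by fun_prop
        map_zero_left := fun y => by
          obtain ⟨x, rfl⟩ := hq y
          change L (q x, 0) = q x
          rw [hL, H0]
        map_one_left := fun y => by
          obtain ⟨x, rfl⟩ := hq y
          change L (q x, 1) = q (g (q x))
          rw [hL]
          exact congrArg q (DFunLike.congr_fun hg x).symm }

end Crush

/-! ### Homotopy extension for attached simplices -/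

section Extension

variable {V : Type*}

/-- The part of the barycentre of `σ` to be removed up to time `t` from a point `x`: the weight that
the barycentre of `σ` has in `x`, cut off at `t / 2`. -/
noncomputable def coreWeight (σ : Finset V) (t : ℝ) (x : V → ℝ) : ℝ :=
  min (σ.card * minCoord σ x) (t / 2)

theorem continuous_coreWeight (σ : Finset V) :
    Continuous fun p : (V → ℝ) × ℝ => coreWeight σ p.2 p.1 := by
  have := (continuous_minCoord σ).comp (continuous_fst (X := V → ℝ) (Y := ℝ))
  unfold coreWeight
  simp only [Function.comp_def] at this
  fun_prop

theorem coreWeight_of_minCoord_eq_zero {σ : Finset V} {t : ℝ} (ht : 0 ≤ t) {x : V → ℝ}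
    (h : minCoord σ x = 0) : coreWeight σ t x = 0 := by
  simp [coreWeight, h, div_nonneg ht zero_le_two]

theorem coreWeight_zero (σ : Finset V) {x : V → ℝ} (hx : ∀ v, 0 ≤ x v) : coreWeight σ 0 x = 0 := by
  have := minCoord_nonneg σ hx
  simp only [coreWeight, zero_div, min_eq_right_iff]
  positivity

theorem IsLowerSet.sdiff_of_maximal {F : Set (Finset V)} (hF : IsLowerSet F) {C : Finset (Finset V)}
    (hmax : ∀ σ ∈ C, ∀ η ∈ F, σ ⊆ η → η = σ) : IsLowerSet (F \ C) := by
  intro σ η hησ hσ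
  refine ⟨hF hησ hσ.1, fun hη => hσ.2 ?_⟩
  rw [hmax η hη σ hσ.1 hησ]
  exact hη

variable [DecidableEq V]

/-- The projection away from the barycentres of the faces in `C`, which moves a point outwards until
it meets the boundary of its face or the time given to it is spent. -/
noncomputable def pushOut (C : Finset (Finset V)) (t : ℝ) (x : V → ℝ) : V → ℝ := fun w =>
  (x w - ∑ σ ∈ C, coreWeight σ t x * (if w ∈ σ then (σ.card : ℝ)⁻¹ else 0)) /
    (1 - ∑ σ ∈ C, coreWeight σ t x)

variable [Fintype V]

/-- The projection on points whose support is a face of `C`, with only one active barycentre. -/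
theorem pushOut_of_support_mem {C : Finset (Finset V)} {F : Set (Finset V)}
    (hmax : ∀ σ ∈ C, ∀ η ∈ F, σ ⊆ η → η = σ) {x : V → ℝ} (hx : x ∈ geomRealization F)
    {t : ℝ} (ht : 0 ≤ t) {σ : Finset V} (hσ : σ ∈ C)
    (hs : Finset.univ.filter (fun v => x v ≠ 0) = σ) :
    (∑ η ∈ C, coreWeight η t x = coreWeight σ t x) ∧ ∀ w, pushOut C t x w =
      (x w - coreWeight σ t x * (if w ∈ σ then (σ.card : ℝ)⁻¹ else 0)) /
        (1 - coreWeight σ t x) := by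
  have h0 : ∀ η ∈ C, η ≠ σ → coreWeight η t x = 0 := by
    intro η hη hne
    refine coreWeight_of_minCoord_eq_zero ht (minCoord_eq_zero hx.1.1 fun hsub => hne ?_)
    rw [← hs, hmax η hη _ hx.2 hsub]
  have h1 : ∑ η ∈ C, coreWeight η t x = coreWeight σ t x :=
    Finset.sum_eq_single_of_mem σ hσ h0
  refine ⟨h1, fun w => ?_⟩
  unfold pushOut
  rw [h1, Finset.sum_eq_single_of_mem σ hσ]
  intro η hη hne
  rw [h0 η hη hne, zero_mul]

theorem pushOut_of_support_notMem {C : Finset (Finset V)} {F : Set (Finset V)}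
    (hmax : ∀ σ ∈ C, ∀ η ∈ F, σ ⊆ η → η = σ) {x : V → ℝ} (hx : x ∈ geomRealization F)
    {t : ℝ} (ht : 0 ≤ t) (hs : Finset.univ.filter (fun v => x v ≠ 0) ∉ C) :
    (∑ η ∈ C, coreWeight η t x = 0) ∧ pushOut C t x = x := by
  have h0 : ∀ η ∈ C, coreWeight η t x = 0 := by
    intro η hη
    refine coreWeight_of_minCoord_eq_zero ht (minCoord_eq_zero hx.1.1 fun hsub => hs ?_)
    rw [hmax η hη _ hx.2 hsub]
    exact hη
  have h1 := Finset.sum_eq_zero h0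
  refine ⟨h1, funext fun w => ?_⟩
  unfold pushOut
  rw [h1, Finset.sum_eq_zero fun η hη => by rw [h0 η hη, zero_mul]]
  simp

theorem pushOut_mem {C : Finset (Finset V)} {F : Set (Finset V)} (hF : IsLowerSet F)
    (hmax : ∀ σ ∈ C, ∀ η ∈ F, σ ⊆ η → η = σ) (hne : ∅ ∉ C) {x : V → ℝ}
    (hx : x ∈ geomRealization F) {t : ℝ} (ht : 0 ≤ t) (ht1 : t ≤ 1) :
    pushOut C t x ∈ geomRealization F ∧
      0 ≤ ∑ σ ∈ C, coreWeight σ t x ∧ 2 * ∑ σ ∈ C, coreWeight σ t x ≤ t ∧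
      (2 * ∑ σ ∈ C, coreWeight σ t x ≠ t → pushOut C t x ∈ geomRealization (F \ C)) := by
  by_cases hs : Finset.univ.filter (fun v => x v ≠ 0) ∈ C
  swap
  · obtain ⟨h1, h2⟩ := pushOut_of_support_notMem hmax hx ht hs
    rw [h1, h2]
    exact ⟨hx, le_rfl, by simpa using ht, fun _ => ⟨hx.1, hx.2, hs⟩⟩
  obtain ⟨σ, hσ, hsσ⟩ : ∃ σ ∈ C, Finset.univ.filter (fun v => x v ≠ 0) = σ := ⟨_, hs, rfl⟩
  obtain ⟨h1, h2⟩ := pushOut_of_support_mem hmax hx ht hσ hsσ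
  have hσne : σ.Nonempty := Finset.nonempty_iff_ne_empty.2 fun h => hne (h ▸ hσ)
  have hcard : (0 : ℝ) < σ.card := by exact_mod_cast hσne.card_pos
  have hm := minCoord_nonneg σ hx.1.1
  have hle : coreWeight σ t x ≤ σ.card * minCoord σ x := min_le_left _ _
  have hle' : coreWeight σ t x ≤ t / 2 := min_le_right _ _
  have hnn : 0 ≤ coreWeight σ t x := le_min (by positivity) (by positivity)
  have hpos : 0 < 1 - coreWeight σ t x := by linarith
  have hsub : Finset.univ.filter (fun v => pushOut C t x v ≠ 0) ⊆ σ := by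
    intro w hw
    by_contra hc
    have hxw : x w = 0 := by
      by_contra h0
      exact hc (hsσ ▸ by simpa using h0)
    exact (Finset.mem_filter.1 hw).2 (by rw [h2]; simp [hxw, hc])
  have hsimp : pushOut C t x ∈ stdSimplex ℝ V := by
    refine ⟨fun w => ?_, ?_⟩
    · rw [h2]
      refine div_nonneg ?_ hpos.le
      split_ifs with hw
      · have hb : coreWeight σ t x * (σ.card : ℝ)⁻¹ ≤ minCoord σ x := by
          rw [← div_eq_mul_inv, div_le_iff₀ hcard]
          linarith
        linarith [minCoord_le x hw]
      · simpa using hx.1.1 w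
    · simp only [h2]
      rw [← Finset.sum_div, Finset.sum_sub_distrib, hx.1.2, ← Finset.mul_sum]
      simp only [Finset.sum_ite_mem, Finset.univ_inter, Finset.sum_const, nsmul_eq_mul]
      rw [mul_inv_cancel₀ hcard.ne', mul_one, div_self hpos.ne']
  have hFmem := hF hsub (hsσ ▸ hx.2)
  rw [h1]
  refine ⟨⟨hsimp, hFmem⟩, hnn, by linarith, fun hlt => ⟨hsimp, hFmem, fun hc => ?_⟩⟩
  -- time is left over, so the boundary has been reached and a vertex of `σ` has left the support
  have hcw : coreWeight σ t x = σ.card * minCoord σ x := by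
    rcases min_choice (σ.card * minCoord σ x) (t / 2) with h | h
    · exact h
    · exact absurd (by rw [coreWeight, h]; ring) hlt
  obtain ⟨u, hu, hux⟩ := exists_eq_minCoord hσne x
  have h0 : pushOut C t x u = 0 := by
    rw [h2, hcw, if_pos hu, hux, div_eq_zero_iff]
    left
    field_simp
    ring
  have hu' : u ∈ Finset.univ.filter (fun v => pushOut C t x v ≠ 0) := by
    rw [hmax _ hc σ (hsσ ▸ hx.2) hsub] at hu
    exact hu
  exact (Finset.mem_filter.1 hu').2 h0

/-- A complex has the homotopy extension property relative to the subcomplex obtained by removing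
some maximal faces. -/
theorem extendsHomotopies_sdiff {F : Set (Finset V)} (hF : IsLowerSet F) {C : Finset (Finset V)}
    (hmax : ∀ σ ∈ C, ∀ η ∈ F, σ ⊆ η → η = σ) (hne : ∅ ∉ C) :
    ExtendsHomotopies {x : geomRealization F | (x : V → ℝ) ∈ geomRealization (F \ C)} := by
  classical
  set A : Set (geomRealization F) :=
    {x : geomRealization F | (x : V → ℝ) ∈ geomRealization (F \ C)}
  intro h h0
  have key := fun p : geomRealization F × unitInterval =>
    pushOut_mem hF hmax hne p.1.2 p.2.2.1 p.2.2.2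
  let m : geomRealization F × unitInterval → ℝ := fun p => ∑ σ ∈ C, coreWeight σ p.2 p.1
  have hm : Continuous m := continuous_finsetSum _ fun σ _ =>
    (continuous_coreWeight σ).comp ((continuous_subtype_val.comp continuous_fst).prodMk
      (continuous_subtype_val.comp continuous_snd))
  let r : geomRealization F × unitInterval → geomRealization F := fun p =>
    ⟨pushOut C p.2 p.1, (key p).1⟩
  have hr : Continuous r := by
    refine Continuous.subtype_mk (continuous_pi fun w => ?_) _
    refine Continuous.div ?_ (continuous_const.sub hm) fun p => ?_
    · refine Continuous.sub ((continuous_apply w).comp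
        (continuous_subtype_val.comp continuous_fst)) ?_
      refine continuous_finsetSum _ fun σ _ => Continuous.mul ?_ continuous_const
      exact (continuous_coreWeight σ).comp ((continuous_subtype_val.comp continuous_fst).prodMk
        (continuous_subtype_val.comp continuous_snd))
    · have h1 := (key p).2.2.1
      have h2 := p.2.2.2
      intro h3
      linarith
  let s : geomRealization F × unitInterval → unitInterval := fun p =>
    ⟨p.2 - 2 * m p, by linarith [(key p).2.2.1], by linarith [(key p).2.1, p.2.2.2]⟩
  have hs : Continuous s := Continuous.subtype_mk (by fun_prop) _
  let H : geomRealization F × unitInterval → geomRealization F := fun p =>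
    if hp : r p ∈ A then h (⟨r p, hp⟩, s p) else r p
  have hcA : IsClosed (r ⁻¹' A) := by
    refine IsClosed.preimage hr ?_
    exact (isClosed_geomRealization (hF.sdiff_of_maximal hmax)).preimage continuous_subtype_val
  have hcB : IsClosed {p | s p = 0} := isClosed_eq hs continuous_const
  have hcont : Continuous H := by
    have hU : r ⁻¹' A ∪ {p | s p = 0} = Set.univ := by
      refine Set.eq_univ_of_forall fun p => ?_
      by_cases hp : 2 * m p = p.2
      · exact Or.inr (Subtype.ext (by simp [s, hp]))
      · exact Or.inl ((key p).2.2.2 hp)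
    rw [← continuousOn_univ, ← hU]
    refine ContinuousOn.union_of_isClosed ?_ ?_ hcA hcB
    · rw [continuousOn_iff_continuous_domRestrict]
      have : (r ⁻¹' A).domRestrict H = fun p => h (⟨r p.1, p.2⟩, s p.1) := by
        ext p : 1
        exact dif_pos (show r p ∈ A from p.2)
      rw [this]
      fun_prop
    · refine hr.continuousOn.congr fun p hp => ?_
      change (if hp : r p ∈ A then h (⟨r p, hp⟩, s p) else r p) = r p
      split_ifs with hp'
      · rw [show s p = 0 from hp, h0]
      · rfl
  have hstay : ∀ (a : A) (t : unitInterval), r (a, t) = a ∧ s (a, t) = t := by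
    intro a t
    obtain ⟨h1, h2⟩ := pushOut_of_support_notMem hmax a.1.2 t.2.1 a.2.2.2
    exact ⟨Subtype.ext h2, Subtype.ext (by simp [s, m, h1])⟩
  refine ⟨⟨H, hcont⟩, fun x => ?_, fun a t => ?_⟩
  · have hr0 : r (x, 0) = x := by
      have h0 : ∀ σ ∈ C, coreWeight σ 0 (x : V → ℝ) = 0 := fun σ _ => coreWeight_zero σ x.2.1.1
      refine Subtype.ext (funext fun w => ?_)
      change pushOut C 0 x w = _
      unfold pushOut
      rw [Finset.sum_eq_zero h0, Finset.sum_eq_zero fun η hη => by rw [h0 η hη, zero_mul]]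
      simp
    have hs0 : s (x, 0) = 0 := by
      have h1 := (key (x, 0)).2.1
      have h2 := (key (x, 0)).2.2.1
      refine Subtype.ext ?_
      simp only [Set.Icc.coe_zero] at h1 h2 ⊢
      change (0 : ℝ) - 2 * ∑ σ ∈ C, coreWeight σ 0 (x : V → ℝ) = 0
      linarith
    change (if hp : r (x, 0) ∈ A then h (⟨r (x, 0), hp⟩, s (x, 0)) else r (x, 0)) = x
    split_ifs with hp'
    · rw [hs0, h0]
      exact hr0
    · exact hr0
  · obtain ⟨h1, h2⟩ := hstay a t
    change (if hp : r (a, t) ∈ A then h (⟨r (a, t), hp⟩, s (a, t)) else r (a, t)) = _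
    have hp : r (a, t) ∈ A := by rw [h1]; exact a.2
    rw [dif_pos hp]
    exact congrArg h (Prod.ext (Subtype.ext h1) h2)

end Extension

/-! ### Wedges -/

section WedgeLemmas

variable {ι : Type*} {X : ι → Type*} (p : ∀ i, X i)

/-- The base point of a wedge. -/
def Wedge.basePoint : Wedge p := Quot.mk _ (Sum.inl ())

/-- The inclusion of a summand in a wedge. -/
def Wedge.incl (i : ι) (x : X i) : Wedge p := Quot.mk _ (Sum.inr ⟨i, x⟩)

theorem Wedge.incl_base (i : ι) : Wedge.incl p i (p i) = Wedge.basePoint p :=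
  (Quot.sound (WedgeRel.glue i)).symm

theorem Wedge.cases (y : Wedge p) : y = Wedge.basePoint p ∨ ∃ i x, y = Wedge.incl p i x := by
  induction y using Quot.ind with
  | mk a =>
    rcases a with ⟨⟩ | ⟨i, x⟩
    · exact Or.inl rfl
    · exact Or.inr ⟨i, x, rfl⟩

open Classical in
/-- The map from a wedge to the product of its summands, as the union of the coordinate axes. -/
noncomputable def Wedge.toProd : Wedge p → ∀ i, X i :=
  Quot.lift (Sum.elim (fun _ => p) fun a => Function.update p a.1 a.2) <| by
    rintro _ _ ⟨i⟩
    simp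

@[simp]
theorem Wedge.toProd_basePoint : Wedge.toProd p (Wedge.basePoint p) = p := rfl

open Classical in
theorem Wedge.toProd_incl (i : ι) (x : X i) :
    Wedge.toProd p (Wedge.incl p i x) = Function.update p i x := rfl

theorem Wedge.toProd_incl_self (i : ι) (x : X i) : Wedge.toProd p (Wedge.incl p i x) i = x := by
  simp [Wedge.toProd_incl]

theorem Wedge.toProd_incl_of_ne {i j : ι} (h : j ≠ i) (x : X i) :
    Wedge.toProd p (Wedge.incl p i x) j = p j := by
  simp [Wedge.toProd_incl, h]

theorem Wedge.toProd_injective : Function.Injective (Wedge.toProd p) := by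
  intro y z h
  rcases Wedge.cases p y with rfl | ⟨i, x, rfl⟩ <;> rcases Wedge.cases p z with rfl | ⟨j, x', rfl⟩
  · rfl
  · have := congrFun h j
    rw [Wedge.toProd_incl_self, Wedge.toProd_basePoint] at this
    rw [← this, Wedge.incl_base]
  · have := congrFun h i
    rw [Wedge.toProd_incl_self, Wedge.toProd_basePoint] at this
    rw [this, Wedge.incl_base]
  · by_cases hij : i = j
    · subst hij
      have := congrFun h i
      rw [Wedge.toProd_incl_self, Wedge.toProd_incl_self] at this
      rw [this]
    · have h1 := congrFun h i
      have h2 := congrFun h j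
      rw [Wedge.toProd_incl_self, Wedge.toProd_incl_of_ne p hij] at h1
      rw [Wedge.toProd_incl_self, Wedge.toProd_incl_of_ne p (Ne.symm hij)] at h2
      rw [h1, ← h2, Wedge.incl_base, Wedge.incl_base]

variable [∀ i, TopologicalSpace (X i)]

theorem Wedge.continuous_toProd : Continuous (Wedge.toProd p) := by
  classical
  refine continuous_quot_lift _ ?_
  refine continuous_sum_dom.2 ⟨continuous_const, ?_⟩
  refine continuous_sigma fun i => ?_
  exact continuous_const.update i continuous_id

instance [∀ i, T2Space (X i)] : T2Space (Wedge p) :=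
  T2Space.of_injective_continuous (Wedge.toProd_injective p) (Wedge.continuous_toProd p)

instance [Finite ι] [∀ i, CompactSpace (X i)] : CompactSpace (Wedge p) :=
  inferInstanceAs (CompactSpace (Quot (WedgeRel p)))

theorem Wedge.isEmbedding_toProd [Finite ι] [∀ i, CompactSpace (X i)] [∀ i, T2Space (X i)] :
    Topology.IsEmbedding (Wedge.toProd p) :=
  ((Wedge.continuous_toProd p).isClosedEmbedding (Wedge.toProd_injective p)).isEmbedding

end WedgeLemmas

/-! ### Crushing the boundary of a simplex to obtain a sphere -/

section Sphere

/-- The one-point compactification of a `d`-dimensional real vector space is a sphere, with `∞`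
as its base point. -/
theorem exists_onePoint_homeomorph_sphere {E : Type*} [NormedAddCommGroup E] [NormedSpace ℝ E]
    [FiniteDimensional ℝ E] {d : ℕ} (hd : Module.finrank ℝ E = d) :
    ∃ e : OnePoint E ≃ₜ UnitSphere d, e OnePoint.infty = UnitSphere.base d := by
  have hv : ‖(EuclideanSpace.single 0 1 : EuclideanSpace ℝ (Fin (d + 1)))‖ = 1 := by simp
  have hv₀ : (EuclideanSpace.single 0 1 : EuclideanSpace ℝ (Fin (d + 1))) ≠ 0 := by
    intro h
    simp [h] at hv
  have : Fact (Module.finrank ℝ (EuclideanSpace ℝ (Fin (d + 1))) = d + 1) := ⟨by simp⟩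
  have hV := Submodule.finrank_orthogonal_span_singleton (𝕜 := ℝ) (n := d) hv₀
  let e : E ≃ₜ (Submodule.span ℝ {(EuclideanSpace.single 0 1 : EuclideanSpace ℝ (Fin (d + 1)))})ᗮ :=
    (FiniteDimensional.nonempty_continuousLinearEquiv_of_finrank_eq
      (hd.trans hV.symm)).some.toHomeomorph
  exact ⟨e.onePointCongr.trans (onePointHyperplaneHomeoUnitSphere hv), rfl⟩

/-- Crushing the complement of an open set `U` of a compact Hausdorff space gives the one-point
compactification of `U`. -/
theorem exists_continuous_to_onePoint {X E : Type*} [TopologicalSpace X] [TopologicalSpace E]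
    [T2Space X] {U : Set X} (hU : IsOpen U) (φ : U ≃ₜ E) :
    ∃ c : C(X, OnePoint E), (∀ x : U, c x = φ x) ∧ ∀ x ∉ U, c x = OnePoint.infty := by
  classical
  let c : X → OnePoint E := fun x => if h : x ∈ U then ((φ ⟨x, h⟩ : E) : OnePoint E)
    else OnePoint.infty
  have hc : ∀ x : U, c x = φ x := fun x => dif_pos x.2
  have hc' : ∀ x ∉ U, c x = OnePoint.infty := fun x hx => dif_neg hx
  refine ⟨⟨c, continuous_def.2 fun s hs => ?_⟩, hc, hc'⟩
  rw [OnePoint.isOpen_def] at hs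
  by_cases hinf : OnePoint.infty ∈ s
  · have h1 : c ⁻¹' s = (Subtype.val '' (φ.symm '' (((↑) : E → OnePoint E) ⁻¹' s)ᶜ))ᶜ := by
      ext x
      by_cases hx : x ∈ U
      · have := hc ⟨x, hx⟩
        simp [this, hx, φ.symm_apply_eq]
      · simp only [Set.mem_preimage, hc' x hx, hinf, Set.mem_compl_iff, true_iff]
        rintro ⟨x', -, rfl⟩
        exact hx x'.2
    rw [h1, isOpen_compl_iff]
    exact (((hs.1 hinf).image φ.symm.continuous).image continuous_subtype_val).isClosed
  · have h1 : c ⁻¹' s = Subtype.val '' (φ ⁻¹' (((↑) : E → OnePoint E) ⁻¹' s)) := by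
      ext x
      by_cases hx : x ∈ U
      · have := hc ⟨x, hx⟩
        simp [this, hx]
      · simp [hc' x hx, hx, hinf]
    rw [h1]
    exact hU.isOpenMap_subtype_val _ (hs.2.preimage φ.continuous)

variable {V : Type*} [Fintype V] [DecidableEq V]

/-- The open simplex spanned by a face is homeomorphic to a vector space, by logarithms of ratios of
barycentric coordinates; the inverse is the softmax function. -/
noncomputable def openSimplexHomeomorph (F : Set (Finset V)) {σ : Finset V} (hσ : σ ∈ F) {u₀ : V}
    (hu₀ : u₀ ∈ σ) :
    {x : geomRealization F | Finset.univ.filter (fun v => (x : V → ℝ) v ≠ 0) = σ} ≃ₜ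
      ({u // u ∈ σ.erase u₀} → ℝ) where
  toFun x u := Real.log ((x : V → ℝ) u) - Real.log ((x : V → ℝ) u₀)
  invFun y :=
    let z : V → ℝ := fun w => Real.exp (if h : w ∈ σ.erase u₀ then y ⟨w, h⟩ else 0)
    have hpos : 0 < ∑ w ∈ σ, z w := Finset.sum_pos (fun _ _ => Real.exp_pos _) ⟨u₀, hu₀⟩
    have hsupp :
        Finset.univ.filter (fun w => (if w ∈ σ then z w / ∑ w ∈ σ, z w else 0) ≠ 0) = σ := by
      ext w
      have hw : z w ≠ 0 := (Real.exp_pos _).ne'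
      simp [hw, hpos.ne']
    ⟨⟨fun w => if w ∈ σ then z w / ∑ w ∈ σ, z w else 0, ⟨fun w => by
        dsimp only
        split_ifs
        · exact div_nonneg (Real.exp_pos _).le hpos.le
        · exact le_rfl, by
        rw [Finset.sum_ite_mem, Finset.univ_inter, ← Finset.sum_div, div_self hpos.ne']⟩,
      by rw [hsupp]; exact hσ⟩, hsupp⟩
  left_inv := by
    rintro ⟨⟨x, hx⟩, hs : _ = σ⟩
    have hne : ∀ w, x w ≠ 0 ↔ w ∈ σ := fun w => by rw [← hs]; simp
    have hpos : ∀ w ∈ σ, 0 < x w := fun w hw => lt_of_le_of_ne (hx.1.1 w) ((hne w).2 hw).symm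
    have hz : ∀ w ∈ σ, Real.exp (if w ∈ σ.erase u₀ then Real.log (x w) - Real.log (x u₀) else 0)
        = x w / x u₀ := by
      intro w hw
      by_cases h : w = u₀
      · simp [h, (hpos u₀ hu₀).ne']
      · rw [if_pos (Finset.mem_erase.2 ⟨h, hw⟩), Real.exp_sub, Real.exp_log (hpos w hw),
          Real.exp_log (hpos u₀ hu₀)]
    have hsum : ∑ w ∈ σ, x w = 1 := by
      rw [← hx.1.2]
      refine Finset.sum_subset (Finset.subset_univ _) fun w _ hw => ?_
      by_contra h
      exact hw ((hne w).1 h)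
    refine Subtype.ext (Subtype.ext (funext fun w => ?_))
    simp only [dite_eq_ite]
    rw [Finset.sum_congr rfl hz, ← Finset.sum_div, hsum]
    by_cases hw : w ∈ σ
    · rw [if_pos hw, hz w hw]
      field_simp [(hpos u₀ hu₀).ne']
    · rw [if_neg hw]
      by_contra h
      exact hw ((hne w).1 (Ne.symm h))
  right_inv := by
    intro y
    have hpos : 0 < ∑ w ∈ σ, Real.exp (if h : w ∈ σ.erase u₀ then y ⟨w, h⟩ else 0) :=
      Finset.sum_pos (fun _ _ => Real.exp_pos _) ⟨u₀, hu₀⟩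
    funext u
    have hu := Finset.mem_erase.1 u.2
    dsimp only
    rw [if_pos hu.2, if_pos hu₀, Real.log_div (Real.exp_pos _).ne' hpos.ne',
      Real.log_div (Real.exp_pos _).ne' hpos.ne', Real.log_exp, Real.log_exp, dif_pos u.2,
      dif_neg (by simp)]
    ring
  continuous_toFun := by
    refine continuous_pi fun u => ?_
    have hcont : ∀ w : V, Continuous fun x : {x : geomRealization F |
        Finset.univ.filter (fun v => (x : V → ℝ) v ≠ 0) = σ} =>
          ((x : geomRealization F) : V → ℝ) w :=
      fun w => (continuous_apply w).comp (continuous_subtype_val.comp continuous_subtype_val)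
    have hne : ∀ w ∈ σ, ∀ x : {x : geomRealization F |
        Finset.univ.filter (fun v => (x : V → ℝ) v ≠ 0) = σ},
        ((x : geomRealization F) : V → ℝ) w ≠ 0 := by
      intro w hw x
      have hx := x.2
      rw [Set.mem_ofPred_eq] at hx
      rw [← hx] at hw
      exact (Finset.mem_filter.1 hw).2
    exact ((hcont u).log (hne u (Finset.mem_erase.1 u.2).2)).sub ((hcont u₀).log (hne u₀ hu₀))
  continuous_invFun := by
    refine Continuous.subtype_mk (Continuous.subtype_mk (continuous_pi fun w => ?_) _) _
    have hcont : ∀ w : V, Continuous fun y : {u // u ∈ σ.erase u₀} → ℝ =>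
        Real.exp (if h : w ∈ σ.erase u₀ then y ⟨w, h⟩ else 0) := by
      intro w
      split_ifs
      · fun_prop
      · fun_prop
    split_ifs with hw
    · refine (hcont w).div (continuous_finsetSum _ fun w _ => hcont w) fun y => ?_
      exact (Finset.sum_pos (fun _ _ => Real.exp_pos _) ⟨u₀, hu₀⟩).ne'
    · exact continuous_const

/-- Crushing the complement of the open simplex of a maximal face of dimension `d` gives a sphere of
dimension `d`. -/
theorem exists_crush_to_sphere {F : Set (Finset V)} {σ : Finset V}
    (hσ : σ ∈ F) (hmax : ∀ η ∈ F, σ ⊆ η → η = σ) {d : ℕ} (hd : σ.card = d + 1) :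
    ∃ c : C(geomRealization F, UnitSphere d),
      (∀ x, c x = UnitSphere.base d ↔ Finset.univ.filter (fun v => (x : V → ℝ) v ≠ 0) ≠ σ) ∧
      (∀ x y, c x = c y → c x ≠ UnitSphere.base d → x = y) ∧
      ∀ z, z ≠ UnitSphere.base d → ∃ x, c x = z := by
  obtain ⟨u₀, hu₀⟩ : σ.Nonempty := Finset.card_pos.1 (by omega)
  set U : Set (geomRealization F) :=
    {x : geomRealization F | Finset.univ.filter (fun v => (x : V → ℝ) v ≠ 0) = σ} with hU
  have hUo : IsOpen U := by
    have h : U = ⋂ u ∈ σ, {x : geomRealization F | (x : V → ℝ) u ≠ 0} := by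
      ext x
      simp only [hU, Set.mem_ofPred_eq, Set.mem_iInter]
      constructor
      · intro h u hu
        rw [← h] at hu
        exact (Finset.mem_filter.1 hu).2
      · intro h
        exact hmax _ x.2.2 fun u hu => Finset.mem_filter.2 ⟨Finset.mem_univ _, h u hu⟩
    rw [h]
    refine isOpen_biInter_finset fun u _ => isOpen_ne_fun ?_ continuous_const
    exact (continuous_apply u).comp continuous_subtype_val
  let φ := openSimplexHomeomorph F hσ hu₀
  obtain ⟨c, hc, hc'⟩ := exists_continuous_to_onePoint hUo φ
  have hfin : Module.finrank ℝ ({u // u ∈ σ.erase u₀} → ℝ) = d := by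
    rw [Module.finrank_fintype_fun_eq_card, Fintype.card_coe, Finset.card_erase_of_mem hu₀, hd]
    rfl
  obtain ⟨e, he⟩ := exists_onePoint_homeomorph_sphere hfin
  have hbase : ∀ x, e (c x) = UnitSphere.base d ↔ x ∉ U := by
    intro x
    rw [← he, e.injective.eq_iff]
    by_cases hx : x ∈ U
    · simp [hc ⟨x, hx⟩, hx]
    · simp [hc' x hx, hx]
  refine ⟨(⟨e, e.continuous⟩ : C(_, _)).comp c, hbase, fun x y hxy hne => ?_, fun z hz => ?_⟩
  · have hx : x ∈ U := by
      by_contra h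
      exact hne ((hbase x).2 h)
    have hy : y ∈ U := by
      by_contra h
      exact hne (hxy.trans ((hbase y).2 h))
    have h := e.injective hxy
    rw [hc ⟨x, hx⟩, hc ⟨y, hy⟩, OnePoint.coe_eq_coe, φ.injective.eq_iff] at h
    exact congrArg Subtype.val h
  · obtain ⟨y, hy⟩ := OnePoint.ne_infty_iff_exists.1 (fun h : e.symm z = OnePoint.infty =>
      hz (by rw [← he, ← h, e.apply_symm_apply]))
    refine ⟨φ.symm y, ?_⟩
    change e (c (φ.symm y)) = z
    rw [hc, φ.apply_symm_apply, hy, e.apply_symm_apply]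

/-- A complex obtained from a contractible subcomplex by attaching `N` simplices of dimension `d` is
homotopy equivalent to a wedge of `N` spheres of dimension `d`. -/
theorem nonempty_homotopyEquiv_wedge {F : Set (Finset V)} (hF : IsLowerSet F)
    {C : Finset (Finset V)} (hCF : ∀ σ ∈ C, σ ∈ F) (hmax : ∀ σ ∈ C, ∀ η ∈ F, σ ⊆ η → η = σ)
    {d : ℕ} (hd : ∀ σ ∈ C, σ.card = d + 1)
    [hP : ContractibleSpace (geomRealization (F \ C))] :
    Nonempty (geomRealization F ≃ₕ WedgeOfSpheres C.card d) := by
  have hne : ∅ ∉ C := fun h => by simpa using hd _ h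
  set A : Set (geomRealization F) :=
    {x : geomRealization F | (x : V → ℝ) ∈ geomRealization (F \ C)} with hA
  have hmemA : ∀ x, x ∈ A ↔ Finset.univ.filter (fun v => (x : V → ℝ) v ≠ 0) ∉ C :=
    fun x => ⟨fun h => h.2.2, fun h => ⟨x.2.1, x.2.2, h⟩⟩
  have hAext : ExtendsHomotopies A := extendsHomotopies_sdiff hF hmax hne
  let ψ : A ≃ₜ geomRealization (F \ C) :=
    { toFun := fun x => ⟨x.1.1, x.2⟩
      invFun := fun x => ⟨⟨x.1, x.2.1, x.2.2.1⟩, x.2⟩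
      left_inv := fun _ => rfl
      right_inv := fun _ => rfl
      continuous_toFun := by fun_prop
      continuous_invFun := by fun_prop }
  have : ContractibleSpace A := ψ.contractibleSpace
  have : CompactSpace (geomRealization F) :=
    isCompact_iff_compactSpace.1 (isCompact_geomRealization hF)
  have e : Fin C.card ≃ C := C.equivFin.symm
  choose c hc hcinj hcsurj using fun i : Fin C.card =>
    exists_crush_to_sphere (hCF _ (e i).2) (hmax _ (e i).2) (hd _ (e i).2)
  let b : Fin C.card → UnitSphere d := fun _ => UnitSphere.base d
  let s : geomRealization F → Finset V := fun x => Finset.univ.filter fun v => (x : V → ℝ) v ≠ 0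
  let q : geomRealization F → WedgeOfSpheres C.card d := fun x =>
    if h : s x ∈ C then Wedge.incl b (e.symm ⟨s x, h⟩) (c (e.symm ⟨s x, h⟩) x)
    else Wedge.basePoint b
  have hqprod : ∀ x i, Wedge.toProd b (q x) i = c i x := by
    intro x i
    by_cases h : s x ∈ C
    · simp only [q, dif_pos h]
      by_cases hi : i = e.symm ⟨s x, h⟩
      · subst hi
        rw [Wedge.toProd_incl_self]
      · rw [Wedge.toProd_incl_of_ne b hi, eq_comm]
        refine (hc i x).2 fun h' => hi ?_
        rw [Equiv.eq_symm_apply]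
        exact Subtype.ext h'.symm
    · simp only [q, dif_neg h, Wedge.toProd_basePoint]
      rw [eq_comm]
      exact (hc i x).2 fun h' => h (by rw [show s x = e i from h']; exact (e i).2)
  have hqc : Continuous q := by
    rw [(Wedge.isEmbedding_toProd b).continuous_iff]
    refine continuous_pi fun i => ?_
    simp only [Function.comp_apply, hqprod]
    exact (c i).continuous
  have hqA : ∀ x ∈ A, q x = Wedge.basePoint b := fun x hx => dif_neg ((hmemA x).1 hx)
  refine nonempty_homotopyEquiv_of_crush hAext ⟨q, hqc⟩ (fun y => ?_) fun x y => ⟨fun h => ?_, ?_⟩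
  · obtain ⟨a⟩ : Nonempty A := inferInstance
    rcases Wedge.cases b y with rfl | ⟨i, z, rfl⟩
    · exact ⟨a, hqA a a.2⟩
    · by_cases hz : z = b i
      · exact ⟨a, by rw [hz, Wedge.incl_base]; exact hqA a a.2⟩
      · obtain ⟨x, hx⟩ := hcsurj i z hz
        refine ⟨x, Wedge.toProd_injective b (funext fun j => ?_)⟩
        change Wedge.toProd b (q x) j = _
        rw [hqprod]
        by_cases hj : j = i
        · subst hj
          rw [Wedge.toProd_incl_self, hx]
        · rw [Wedge.toProd_incl_of_ne b hj]
          refine (hc j x).2 fun h' => ?_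
          have hxi : s x = e i := by
            by_contra h''
            exact hz (hx ▸ (hc i x).2 h'')
          exact hj (e.injective (Subtype.ext (h'.symm.trans hxi)))
  · have hcxy : ∀ i, c i x = c i y := fun i => by
      rw [← hqprod, ← hqprod]
      exact congrArg (fun w => Wedge.toProd b w i) h
    by_cases hxy : ∃ i, c i x ≠ UnitSphere.base d
    · obtain ⟨i, hi⟩ := hxy
      exact Or.inl (hcinj i x y (hcxy i) hi)
    · push Not at hxy
      have hall : ∀ z, (∀ i, c i z = UnitSphere.base d) → z ∈ A := by
        intro z hz
        rw [hmemA]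
        intro hzC
        refine (hc (e.symm ⟨_, hzC⟩) z).1 (hz _) ?_
        rw [e.apply_symm_apply]
      exact Or.inr ⟨hall x hxy, hall y fun i => hcxy i ▸ hxy i⟩
  · rintro (rfl | ⟨hx, hy⟩)
    · rfl
    · exact (hqA x hx).trans (hqA y hy).symm

end Sphere

/-! ### Toggle matchings -/

section Toggle

variable {V : Type*} [DecidableEq V]

/-- A toggle rule selects for each set `σ` a vertex `v σ` to be inserted or removed. The rule is
sequential for the heights `col` if `v σ` can be read off from the part of `σ` strictly below it.
Then `σ` and the result of the toggle select the same vertex, so that toggling is an involution. -/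
def IsSequential (v : Finset V → V) (col : V → ℕ) : Prop :=
  ∀ σ σ' : Finset V, (∀ p, col p < col (v σ) → (p ∈ σ ↔ p ∈ σ')) → v σ' = v σ

variable {v : Finset V → V} {col : V → ℕ}

theorem IsSequential.apply_insert (hv : IsSequential v col) (σ : Finset V) :
    v (insert (v σ) σ) = v σ := by
  refine hv σ _ fun p hp => ?_
  have : p ≠ v σ := fun h => by simp [h] at hp
  simp [this]

theorem IsSequential.apply_erase (hv : IsSequential v col) (σ : Finset V) :
    v (σ.erase (v σ)) = v σ := by
  refine hv σ _ fun p hp => ?_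
  have : p ≠ v σ := fun h => by simp [h] at hp
  simp [this]

/-- The matching is acyclic: the total height increases strictly along gradient paths, which step
from a lower face `η.erase (v η)` up to `η` and down to another lower face `σ`. -/
theorem IsSequential.sum_lt (hv : IsSequential v col) {σ η : Finset V} (hη : v η ∈ η)
    (hsub : σ ⊆ η) (hcard : η.card = σ.card + 1) (hσ : v σ ∉ σ) (hne : η.erase (v η) ≠ σ) :
    ∑ p ∈ η.erase (v η), col p < ∑ p ∈ σ, col p := by
  obtain ⟨u, hu⟩ : ∃ u, η \ σ = {u} := Finset.card_eq_one.1 (by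
    rw [Finset.card_sdiff_of_subset hsub]; omega)
  have huη : u ∈ η ∧ u ∉ σ := Finset.mem_sdiff.1 (hu ▸ Finset.mem_singleton_self u)
  have hση : σ = η.erase u := by
    rw [← Finset.sdiff_singleton_eq_erase, ← hu, Finset.sdiff_sdiff_eq_self hsub]
  have huv : u ≠ v η := fun h => hne (by rw [hση, h])
  have hlt : col u < col (v η) := by
    by_contra hge
    have h1 : v σ = v η := by
      refine hv η σ fun p hp => ?_
      have : p ≠ u := fun h => hge (h ▸ hp)
      simp [hση, this]
    apply hσ
    rw [h1, hση]
    exact Finset.mem_erase.2 ⟨huv.symm, hη⟩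
  have h1 := Finset.sum_erase_add η col hη
  have h2 := Finset.sum_erase_add η col huη.1
  rw [hση]
  omega

variable [Fintype V]

/-- If toggling matches the faces of `F` outside the subcomplex `G` perfectly, then `F` collapses
to `G`. A free pair is found at a lower face of maximal size and, among these, of minimal height. -/
theorem IsSequential.nonempty_homotopyEquiv_of_matched (hv : IsSequential v col)
    {F G : Set (Finset V)} (hF : IsLowerSet F) (hG : IsLowerSet G) (hGF : G ⊆ F) (h0 : ∅ ∈ G)
    (hlow : ∀ σ ∈ F, σ ∉ G → v σ ∉ σ → insert (v σ) σ ∈ F)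
    (hup : ∀ σ ∈ F, σ ∉ G → v σ ∈ σ → σ.erase (v σ) ∉ G) :
    Nonempty (geomRealization F ≃ₕ geomRealization G) := by
  induction hN : (F \ G).ncard using Nat.strong_induction_on generalizing F with
  | _ N ih =>
  by_cases hFG : F ⊆ G
  · rw [hFG.antisymm hGF]
    exact ⟨ContinuousMap.HomotopyEquiv.refl _⟩
  set S : Set (Finset V) := {σ | σ ∈ F ∧ σ ∉ G ∧ v σ ∉ σ} with hS
  have herase : ∀ σ ∈ F, σ ∉ G → v σ ∈ σ → σ.erase (v σ) ∈ S := fun σ h1 h2 h3 =>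
    ⟨hF (Finset.erase_subset _ _) h1, hup σ h1 h2 h3, by simp [hv.apply_erase]⟩
  have hSne : S.Nonempty := by
    obtain ⟨σ, hσF, hσG⟩ := Set.not_subset.1 hFG
    by_cases h : v σ ∈ σ
    · exact ⟨_, herase σ hσF hσG h⟩
    · exact ⟨σ, hσF, hσG, h⟩
  obtain ⟨σ₁, hσ₁, hmax⟩ := Set.exists_max_image S Finset.card S.toFinite hSne
  obtain ⟨σ, ⟨⟨hσF, hσG, hσv⟩, hσc⟩, hmin⟩ := Set.exists_min_image {σ | σ ∈ S ∧ σ.card = σ₁.card}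
    (fun σ => ∑ p ∈ σ, col p) (Set.toFinite _) ⟨σ₁, hσ₁, rfl⟩
  rw [← hσc] at hmax
  have hτ : insert (v σ) σ ∈ F := hlow σ hσF hσG hσv
  have hfree : ∀ η ∈ F, σ ⊆ η → η = σ ∨ η = insert (v σ) σ := by
    intro η hη hsub
    by_contra! hc
    have hηG : η ∉ G := fun h => hσG (hG hsub h)
    have hlt : σ.card < η.card := Finset.card_lt_card (hsub.ssubset_of_ne hc.1.symm)
    by_cases hηv : v η ∈ η
    · have h1 := herase η hη hηG hηv
      have h2 := hmax _ h1
      rw [Finset.card_erase_of_mem hηv] at h2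
      have hcard : η.card = σ.card + 1 := by omega
      by_cases hne : η.erase (v η) = σ
      · apply hc.2
        rw [← hne, hv.apply_erase, Finset.insert_erase hηv]
      · have h3 := hv.sum_lt hηv hsub hcard hσv hne
        have h4 := hmin _ ⟨h1, by rw [Finset.card_erase_of_mem hηv]; omega⟩
        omega
    · have := hmax η ⟨hη, hηG, hηv⟩
      omega
  have hne : σ.Nonempty := Finset.nonempty_iff_ne_empty.2 fun h => hσG (h ▸ h0)
  obtain ⟨e⟩ := nonempty_homotopyEquiv_of_free_pair hF hne hσv hτ hfree
  have hτG : insert (v σ) σ ∉ G := fun h => hσG (hG (Finset.subset_insert _ _) h)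
  have hF' : IsLowerSet (F \ {σ, insert (v σ) σ}) := by
    intro η θ hθη hη
    refine ⟨hF hθη hη.1, fun hθ => ?_⟩
    have hσθ : σ ⊆ θ := by
      rcases hθ with rfl | hθ
      · exact le_rfl
      · rw [Set.mem_singleton_iff] at hθ
        rw [hθ]
        exact Finset.subset_insert _ _
    exact hη.2 (hfree η hη.1 (hσθ.trans hθη))
  obtain ⟨e'⟩ := ih ((F \ {σ, insert (v σ) σ}) \ G).ncard (by
      rw [← hN]
      refine Set.ncard_lt_ncard ?_ (Set.toFinite _)
      refine (Set.ssubset_iff_of_subset (Set.sdiff_subset_sdiff_left Set.sdiff_subset)).2 ?_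
      exact ⟨σ, ⟨hσF, hσG⟩, fun h => h.1.2 (Or.inl rfl)⟩) hF'
    (fun η hη => ⟨hGF hη, fun h => by
      rcases h with rfl | h
      · exact hσG hη
      · rw [Set.mem_singleton_iff] at h
        exact hτG (h ▸ hη)⟩)
    (fun η hη hηG hηv => ⟨hlow η hη.1 hηG hηv, fun h => by
      rcases h with h | h
      · apply hσv
        rw [← h, hv.apply_insert]
        exact Finset.mem_insert_self _ _
      · rw [Set.mem_singleton_iff] at h
        have h1 : v η = v σ := by rw [← hv.apply_insert η, h, hv.apply_insert]
        apply hη.2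
        left
        rw [← Finset.erase_insert hηv, h, h1, Finset.erase_insert hσv]⟩)
    (fun η hη => hup η hη.1) rfl
  exact ⟨e.trans e'⟩

/-- If the critical faces of a sequential toggle rule all have dimension `d`, the complex is
homotopy equivalent to a wedge of `d`-spheres, one for each critical face. -/
theorem IsSequential.nonempty_homotopyEquiv_wedge_of_critical (hv : IsSequential v col)
    {F : Set (Finset V)} (hF : IsLowerSet F) (h0 : {v ∅} ∈ F) {C : Finset (Finset V)}
    (hC : ∀ σ, σ ∈ C ↔ σ ∈ F ∧ v σ ∉ σ ∧ insert (v σ) σ ∉ F) {d : ℕ}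
    (hd : ∀ σ ∈ C, σ.card = d + 1) :
    Nonempty (geomRealization F ≃ₕ WedgeOfSpheres C.card d) := by
  -- `P` consists of the pairs of dimension at most `d`, and `L` of these and the critical faces
  let P : Set (Finset V) := {σ | σ ∈ F ∧ (σ.card ≤ d ∨ (σ.card = d + 1 ∧ v σ ∈ σ))}
  let L : Set (Finset V) := {σ | σ ∈ P ∨ σ ∈ C}
  let B : Set (Finset V) := {∅, {v ∅}}
  have hPC : ∀ σ ∈ P, σ ∉ C := by
    rintro σ ⟨-, h⟩ hσ
    have h1 := hd σ hσ
    rcases h with h | h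
    · omega
    · exact ((hC σ).1 hσ).2.1 h.2
  have hLF : L ⊆ F := by
    rintro σ (h | h)
    · exact h.1
    · exact ((hC σ).1 h).1
  have hLcard : ∀ σ ∈ L, σ.card ≤ d + 1 := by
    rintro σ (⟨-, h | h⟩ | h)
    · omega
    · omega
    · exact (hd σ h).le
  have hL : IsLowerSet L := by
    intro σ η hησ hσ
    rcases eq_or_ne η σ with rfl | hne
    · exact hσ
    · have h1 := Finset.card_lt_card (hησ.lt_of_ne hne)
      have h2 := hLcard σ hσ
      exact Or.inl ⟨hF hησ (hLF hσ), Or.inl (by omega)⟩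
  have hmax : ∀ σ ∈ C, ∀ η ∈ L, σ ⊆ η → η = σ := fun σ hσ η hη hsub =>
    (Finset.eq_of_subset_of_card_le hsub ((hLcard η hη).trans (hd σ hσ).ge)).symm
  have hLP : L \ C = P := by
    ext σ
    exact ⟨fun h => h.1.resolve_right h.2, fun h => ⟨Or.inl h, hPC σ h⟩⟩
  have hP : IsLowerSet P := hLP ▸ hL.sdiff_of_maximal hmax
  have hv0 : v {v ∅} = v ∅ := hv.apply_insert ∅
  have hBP : B ⊆ P := by
    rintro σ (rfl | h)
    · exact ⟨hF (Finset.empty_subset _) h0, by simp⟩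
    · rw [Set.mem_singleton_iff] at h
      subst h
      refine ⟨h0, ?_⟩
      rw [hv0]
      rcases Nat.eq_zero_or_pos d with rfl | hpos
      · simp
      · exact Or.inl (by rw [Finset.card_singleton]; exact hpos)
  have hB : IsLowerSet B := by
    rintro σ η hησ (rfl | h)
    · exact Or.inl (Finset.subset_empty.1 hησ)
    · rw [Set.mem_singleton_iff] at h
      subst h
      exact Finset.subset_singleton_iff.1 hησ
  obtain ⟨e₁⟩ := hv.nonempty_homotopyEquiv_of_matched hF hL hLF (Or.inl (hBP (Or.inl rfl)))
    (fun σ hσ hσL hσv => by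
      by_contra h
      exact hσL (Or.inr ((hC σ).2 ⟨hσ, hσv, h⟩)))
    (fun σ hσ hσL hσv h => by
      have h1 : insert (v (σ.erase (v σ))) (σ.erase (v σ)) = σ := by
        rw [hv.apply_erase, Finset.insert_erase hσv]
      rcases h with ⟨-, h | h⟩ | h
      · rw [Finset.card_erase_of_mem hσv] at h
        refine hσL (Or.inl ⟨hσ, ?_⟩)
        rcases Nat.lt_or_ge d σ.card with h2 | h2
        · exact Or.inr ⟨by omega, hσv⟩
        · exact Or.inl h2
      · rw [hv.apply_erase] at h
        exact Finset.notMem_erase _ _ h.2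
      · exact ((hC _).1 h).2.2 (h1.symm ▸ hσ))
  obtain ⟨e₂⟩ := hv.nonempty_homotopyEquiv_of_matched hP hB hBP (Or.inl rfl)
    (fun σ hσ _ hσv => by
      have h1 : insert (v σ) σ ∈ F := by
        by_contra h
        exact hPC σ hσ ((hC σ).2 ⟨hσ.1, hσv, h⟩)
      have h2 : σ.card ≤ d := hσ.2.resolve_right fun h => hσv h.2
      refine ⟨h1, ?_⟩
      rw [Finset.card_insert_of_notMem hσv, hv.apply_insert]
      rcases h2.lt_or_eq with h3 | h3
      · exact Or.inl h3
      · exact Or.inr ⟨by omega, Finset.mem_insert_self _ _⟩)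
    (fun σ hσ hσB hσv h => by
      have h1 := hv.apply_erase σ
      rcases h with h | h
      · apply hσB
        right
        rw [h] at h1
        have h2 := Finset.insert_erase hσv
        rw [h, insert_empty_eq] at h2
        rw [Set.mem_singleton_iff, h1, h2]
      · rw [Set.mem_singleton_iff] at h
        rw [h, hv0] at h1
        rw [h1] at h
        exact Finset.notMem_erase (v σ) σ (by rw [h]; exact Finset.mem_singleton_self _))
  have hpt : ∀ x ∈ geomRealization B, x = Pi.single (v ∅) 1 := by
    rintro x ⟨hx, hs⟩
    have hsub : Finset.univ.filter (fun w => x w ≠ 0) ⊆ {v ∅} := by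
      rcases hs with h | h
      · rw [h]; exact Finset.empty_subset _
      · exact (Set.mem_singleton_iff.1 h).le
    have hzero : ∀ w, w ≠ v ∅ → x w = 0 := by
      intro w hw
      by_contra h
      exact hw (Finset.mem_singleton.1 (hsub (Finset.mem_filter.2 ⟨Finset.mem_univ _, h⟩)))
    have hone : x (v ∅) = 1 := by
      rw [← hx.2]
      exact (Finset.sum_eq_single _ (fun w _ hw => hzero w hw) (by simp)).symm
    ext w
    by_cases hw : w = v ∅
    · rw [hw, hone, Pi.single_eq_same]
    · rw [hzero w hw, Pi.single_eq_of_ne hw]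
  have hBne : (Pi.single (v ∅) 1 : V → ℝ) ∈ geomRealization B := by
    refine ⟨single_mem_stdSimplex ℝ _, Or.inr (Set.mem_singleton_iff.2 ?_)⟩
    ext w
    simp [Pi.single_apply]
  have : Unique (geomRealization B) :=
    { default := ⟨_, hBne⟩, uniq := fun x => Subtype.ext (hpt x x.2) }
  have : ContractibleSpace (geomRealization B) := inferInstance
  have : ContractibleSpace (geomRealization (L \ C)) := by
    rw [hLP]
    exact e₂.contractibleSpace
  obtain ⟨e₃⟩ := nonempty_homotopyEquiv_wedge hL (fun σ hσ => Or.inr hσ) hmax hd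
  exact ⟨e₁.trans e₃⟩

end Toggle

/-! ### Independent sets of the grid -/

section Grid

theorem gridGraph2_adj {n : ℕ} {p q : Fin 2 × Fin n} : (gridGraph2 n).Adj p q ↔
    (p.1.val = q.1.val ∧ (p.2.val + 1 = q.2.val ∨ q.2.val + 1 = p.2.val)) ∨
      (p.1.val ≠ q.1.val ∧ p.2.val = q.2.val) := by
  simp only [gridGraph2, ne_eq, Fin.ext_iff]

theorem gridVertex_ne {n : ℕ} {p q : Fin 2 × Fin n} :
    p ≠ q ↔ p.1.val ≠ q.1.val ∨ p.2.val ≠ q.2.val := by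
  rw [Ne, Prod.ext_iff, Fin.ext_iff, Fin.ext_iff]
  tauto

theorem SimpleGraph.IsNIndepSet.image {V W : Type*} [DecidableEq W] {G : SimpleGraph V}
    {G' : SimpleGraph W} {k : ℕ} {S : Finset V} (hS : G.IsNIndepSet k S) (g : V → W)
    (hg : ∀ p ∈ S, ∀ q ∈ S, p ≠ q → g p ≠ g q ∧ ¬ G'.Adj (g p) (g q)) :
    G'.IsNIndepSet k (S.image g) := by
  refine ⟨?_, ?_⟩
  · intro a ha b hb hab
    simp only [Finset.coe_image, Set.mem_image, Finset.mem_coe] at ha hb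
    obtain ⟨p, hp, rfl⟩ := ha
    obtain ⟨q, hq, rfl⟩ := hb
    exact (hg p hp q hq fun h => hab (by rw [h])).2
  · rw [Finset.card_image_of_injOn, hS.card_eq]
    intro p hp q hq hpq
    by_contra h
    exact (hg p hp q hq h).1 hpq

/-- The rows of the two colour classes of the grid, as a function of the column. -/
def checkerRow (e c : ℕ) : Fin 2 := if (c + e) % 2 = 0 then 0 else 1

theorem isNIndepSet_checkerboard {n k : ℕ} (e : ℕ) {D : Finset (Fin n)} (hD : D.card = k) :
    (gridGraph2 n).IsNIndepSet k (D.image fun c : Fin n => (checkerRow e c, c)) := by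
  subst hD
  refine ⟨?_, Finset.card_image_of_injective _ fun c c' h => congrArg Prod.snd h⟩
  intro a ha b hb hab
  simp only [Finset.coe_image, Set.mem_image, Finset.mem_coe] at ha hb
  obtain ⟨c, -, rfl⟩ := ha
  obtain ⟨c', -, rfl⟩ := hb
  rw [gridGraph2_adj]
  rw [gridVertex_ne] at hab
  dsimp only at hab ⊢
  unfold checkerRow at hab ⊢
  split_ifs at hab ⊢ <;> simp at hab ⊢ <;> omega

theorem card_le_of_isNIndepSet {n k : ℕ} {S : Finset (Fin 2 × Fin n)}
    (hS : (gridGraph2 n).IsNIndepSet k S) {D : Finset (Fin n)} (hD : ∀ p ∈ S, p.2 ∈ D) :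
    k ≤ D.card := by
  rw [← hS.card_eq]
  refine Finset.card_le_card_of_injOn Prod.snd hD fun p hp q hq hpq => ?_
  by_contra hne
  refine hS.isIndepSet hp hq hne (gridGraph2_adj.2 (Or.inr ⟨?_, congrArg Fin.val hpq⟩))
  rw [← Ne, gridVertex_ne] at hne
  have := congrArg Fin.val hpq
  omega

/-! ### The toggle rule on the grid -/

variable {m : ℕ}

/-- A column other than the last one is split by `σ` if `σ` contains exactly one of its vertices. -/
def IsSplit (σ : Finset (Fin 2 × Fin (m + 1))) (i : Fin m) : Prop :=
  ¬ ((0, i.castSucc) ∈ σ ↔ (1, i.castSucc) ∈ σ)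

open Classical in
/-- The toggle rule: in the first split column find the row of the vertex missing from `σ`, and
toggle the vertex of that row in the next column. If there is no split column, toggle the last vertex
of the first row. -/
noncomputable def gridToggle (σ : Finset (Fin 2 × Fin (m + 1))) : Fin 2 × Fin (m + 1) :=
  if h : ∃ i, IsSplit σ i then
    (if (0, (Fin.find _ h).castSucc) ∈ σ then 1 else 0, (Fin.find _ h).succ)
  else (0, Fin.last m)

theorem isSplit_iff {σ : Finset (Fin 2 × Fin (m + 1))} {i : Fin m} :
    IsSplit σ i ↔ ∃ r : Fin 2, (r, i.castSucc) ∉ σ ∧ (r.rev, i.castSucc) ∈ σ := by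
  have h0 : Fin.rev (0 : Fin 2) = 1 := rfl
  have h1 : Fin.rev (1 : Fin 2) = 0 := rfl
  rw [Fin.exists_fin_two, h0, h1, IsSplit]
  tauto

theorem gridToggle_eq_of_split {σ : Finset (Fin 2 × Fin (m + 1))} {i : Fin m} {r : Fin 2}
    (h1 : (r, i.castSucc) ∉ σ) (h2 : (r.rev, i.castSucc) ∈ σ) (h3 : ∀ j < i, ¬ IsSplit σ j) :
    gridToggle σ = (r, i.succ) := by
  classical
  have hi : IsSplit σ i := isSplit_iff.2 ⟨r, h1, h2⟩
  have h : ∃ i, IsSplit σ i := ⟨i, hi⟩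
  have hfind : Fin.find _ h = i := (Fin.find_eq_iff h).2 ⟨hi, h3⟩
  rw [gridToggle, dif_pos h, hfind]
  rcases Fin.exists_fin_two.1 ⟨r, rfl⟩ with h' | h' <;> subst h'
  · rw [if_neg h1]
  · rw [if_pos (show (0, i.castSucc) ∈ σ from h2)]

theorem gridToggle_eq_of_not_split {σ : Finset (Fin 2 × Fin (m + 1))} (h : ∀ i, ¬ IsSplit σ i) :
    gridToggle σ = (0, Fin.last m) :=
  dif_neg (not_exists.2 h)

theorem gridToggle_cases (σ : Finset (Fin 2 × Fin (m + 1))) :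
    (∃ (i : Fin m) (r : Fin 2), (r, i.castSucc) ∉ σ ∧ (r.rev, i.castSucc) ∈ σ ∧
      (∀ j < i, ¬ IsSplit σ j) ∧ gridToggle σ = (r, i.succ)) ∨
    ((∀ i, ¬ IsSplit σ i) ∧ gridToggle σ = (0, Fin.last m)) := by
  classical
  by_cases h : ∃ i, IsSplit σ i
  · have hmin : ∀ j < Fin.find _ h, ¬ IsSplit σ j := fun j hj => Fin.find_min h hj
    obtain ⟨r, h1, h2⟩ := isSplit_iff.1 (Fin.find_spec h)
    exact Or.inl ⟨_, r, h1, h2, hmin, gridToggle_eq_of_split h1 h2 hmin⟩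
  · exact Or.inr ⟨not_exists.1 h, gridToggle_eq_of_not_split (not_exists.1 h)⟩

theorem isSequential_gridToggle :
    IsSequential (gridToggle (m := m)) (fun p => (p.2 : ℕ)) := by
  intro σ σ' h
  have hs : ∀ j : Fin m, (j : ℕ) < (gridToggle σ).2 → (IsSplit σ' j ↔ IsSplit σ j) := by
    intro j hj
    rw [IsSplit, IsSplit, h (0, j.castSucc) hj, h (1, j.castSucc) hj]
  rcases gridToggle_cases σ with ⟨i, r, h1, h2, h3, h4⟩ | ⟨h1, h2⟩
  · rw [h4] at h hs ⊢
    have hi : (i.castSucc : ℕ) < (i.succ : ℕ) := by simp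
    rw [h _ hi] at h1 h2
    refine gridToggle_eq_of_split h1 h2 fun j hj => ?_
    rw [hs j]
    · exact h3 j hj
    · have : (j : ℕ) < i := hj
      simp only [Fin.val_succ]
      omega
  · rw [h2] at hs ⊢
    refine gridToggle_eq_of_not_split fun i => ?_
    rw [hs i (by simp)]
    exact h1 i

/-- The faces of the total cut complex of the grid, together with the empty set. -/
def gridCutFaces (m k : ℕ) : Set (Finset (Fin 2 × Fin (m + 1))) :=
  {σ | ∃ S : Finset _, S ⊆ σᶜ ∧ (gridGraph2 (m + 1)).IsNIndepSet k S}

theorem isLowerSet_gridCutFaces (m k : ℕ) : IsLowerSet (gridCutFaces m k) := by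
  rintro σ τ h ⟨S, hS, hI⟩
  exact ⟨S, hS.trans (Finset.compl_subset_compl.2 h), hI⟩

theorem rev_notMem_of_not_isSplit {σ : Finset (Fin 2 × Fin (m + 1))} {r : Fin 2} {c : Fin (m + 1)}
    {i : Fin m} (hc : c = i.castSucc) (hi : ¬ IsSplit σ i) (hp : (r, c) ∉ σ) : (r.rev, c) ∉ σ := by
  subst hc
  exact fun h => hi (isSplit_iff.2 ⟨r, hp, h⟩)

/-- If there is a split column, inserting the toggled vertex preserves faces: in an independent set
of the complement, the toggled vertex can be exchanged for the vertex before it. Should this create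
a conflict with the column before, the two rows are swapped in all columns to the left of the
split column. -/
theorem insert_mem_gridCutFaces_of_split {k : ℕ} {σ : Finset (Fin 2 × Fin (m + 1))} {i : Fin m}
    {r : Fin 2} (h1 : (r, i.castSucc) ∉ σ) (h2 : (r.rev, i.castSucc) ∈ σ)
    (h3 : ∀ j < i, ¬ IsSplit σ j) (hσ : σ ∈ gridCutFaces m k) :
    insert (r, i.succ) σ ∈ gridCutFaces m k := by
  classical
  obtain ⟨S, hS, hI⟩ := hσ
  have hSσ : ∀ p ∈ S, p ∉ σ := fun p hp => Finset.mem_compl.1 (hS hp)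
  by_cases hv : (r, i.succ) ∈ S
  swap
  · refine ⟨S, fun p hp => ?_, hI⟩
    rw [Finset.mem_compl, Finset.mem_insert]
    rintro (rfl | h)
    · exact hv hp
    · exact hSσ p hp h
  have hadj : ∀ p ∈ S, ∀ q ∈ S, p ≠ q → ¬ (gridGraph2 (m + 1)).Adj p q :=
    fun p hp q hq hne => hI.isIndepSet hp hq hne
  -- no vertex of `S` lies in the split column
  have hcol : ∀ p ∈ S, p.2.val ≠ i.val := by
    intro p hp hpi
    have hp2 : p.2 = i.castSucc := Fin.ext hpi
    by_cases hpr : p.1 = r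
    · refine hadj p hp _ hv ?_ (gridGraph2_adj.2 (Or.inl ⟨by rw [hpr], Or.inl ?_⟩))
      · rw [gridVertex_ne]
        right
        simp [hpi]
      · simp [hpi]
    · have : p.1 = r.rev := by
        apply Fin.ext
        have := Fin.val_ne_of_ne hpr
        rw [Fin.val_rev]
        omega
      exact hSσ p hp (by rw [show p = (r.rev, i.castSucc) from Prod.ext this hp2]; exact h2)
  let flag : Prop := ∃ p ∈ S, p.1.val = r.val ∧ p.2.val + 1 = i.val
  let g : Fin 2 × Fin (m + 1) → Fin 2 × Fin (m + 1) := fun p =>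
    if p.2.val < i.val then (if flag then (p.1.rev, p.2) else p)
    else if p = (r, i.succ) then (r, i.castSucc) else p
  refine ⟨S.image g, ?_, hI.image g ?_⟩
  · intro q hq
    obtain ⟨p, hp, rfl⟩ := Finset.mem_image.1 hq
    rw [Finset.mem_compl, Finset.mem_insert, not_or, ← Ne, gridVertex_ne]
    have hpσ := hSσ p hp
    simp only [g]
    split_ifs with hlt hf hpv
    · refine ⟨Or.inr ?_, ?_⟩
      · simp only [Fin.val_succ]
        omega
      · exact rev_notMem_of_not_isSplit (i := ⟨p.2.val, by omega⟩) rfl (h3 _ hlt) hpσ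
    · refine ⟨Or.inr ?_, hpσ⟩
      simp only [Fin.val_succ]
      omega
    · exact ⟨Or.inr (by simp), h1⟩
    · exact ⟨gridVertex_ne.1 hpv, hpσ⟩
  · intro p hp q hq hne
    have hpq := hadj p hp q hq hne
    have hp1 := hcol p hp
    have hq1 := hcol q hq
    -- on the vertices just before the split column, the swap has the right effect
    have hflag : ∀ a ∈ S, a.2.val + 1 = i.val → (flag ↔ a.1.val = r.val) := by
      intro a ha hai
      refine ⟨fun ⟨b, hb, hb1, hb2⟩ => ?_, fun h => ⟨a, ha, h, hai⟩⟩
      by_contra hab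
      refine hadj a ha b hb ?_ (gridGraph2_adj.2 (Or.inr ⟨?_, ?_⟩))
      · exact gridVertex_ne.2 (Or.inl (by omega))
      · omega
      · omega
    have hpf := hflag p hp
    have hqf := hflag q hq
    rw [gridGraph2_adj] at hpq ⊢
    rw [gridVertex_ne] at hne ⊢
    have hr := r.isLt
    have hp0 := p.1.isLt
    have hq0 := q.1.isLt
    have hpv : p = (r, i.succ) ↔ p.1.val = r.val ∧ p.2.val = i.val + 1 := by
      rw [Prod.ext_iff, Fin.ext_iff, Fin.ext_iff, Fin.val_succ]
    have hqv : q = (r, i.succ) ↔ q.1.val = r.val ∧ q.2.val = i.val + 1 := by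
      rw [Prod.ext_iff, Fin.ext_iff, Fin.ext_iff, Fin.val_succ]
    by_cases hf : flag
    all_goals
      simp only [hf, true_iff, false_iff] at hpf hqf
      simp only [g, hf, hpv, hqv, if_true, if_false]
      split_ifs
      all_goals
        try simp only [Fin.val_rev, Fin.val_castSucc]
        omega

/-- If there is no split column and the last column misses `σ`, swapping the two rows shows that
inserting the toggled vertex preserves faces. -/
theorem insert_mem_gridCutFaces_of_last {k : ℕ} {σ : Finset (Fin 2 × Fin (m + 1))}
    (h : ∀ i, ¬ IsSplit σ i) (h1 : (1, Fin.last m) ∉ σ) (hσ : σ ∈ gridCutFaces m k) :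
    insert (0, Fin.last m) σ ∈ gridCutFaces m k := by
  classical
  obtain ⟨S, hS, hI⟩ := hσ
  have hSσ : ∀ p ∈ S, p ∉ σ := fun p hp => Finset.mem_compl.1 (hS hp)
  by_cases hv : (0, Fin.last m) ∈ S
  swap
  · refine ⟨S, fun p hp => ?_, hI⟩
    rw [Finset.mem_compl, Finset.mem_insert]
    rintro (rfl | h)
    · exact hv hp
    · exact hSσ p hp h
  have hadj : ∀ p ∈ S, ∀ q ∈ S, p ≠ q → ¬ (gridGraph2 (m + 1)).Adj p q :=
    fun p hp q hq hne => hI.isIndepSet hp hq hne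
  have hlast : ∀ p ∈ S, p.2.val = m → p.1.val = 0 := by
    intro p hp hpm
    by_contra h0
    refine hadj p hp _ hv (gridVertex_ne.2 (Or.inl ?_)) (gridGraph2_adj.2 (Or.inr ⟨?_, ?_⟩))
    · simpa using h0
    · simpa using h0
    · simpa using hpm
  refine ⟨S.image fun p => (p.1.rev, p.2), ?_, hI.image _ ?_⟩
  · intro q hq
    obtain ⟨p, hp, rfl⟩ := Finset.mem_image.1 hq
    rw [Finset.mem_compl, Finset.mem_insert, not_or, ← Ne, gridVertex_ne]
    have hpσ := hSσ p hp
    by_cases hpm : p.2.val = m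
    · have h0 := hlast p hp hpm
      have h2 : ((p.1.rev, p.2) : Fin 2 × Fin (m + 1)) = (1, Fin.last m) :=
        Prod.ext (Fin.ext (by rw [Fin.val_rev, h0]; rfl)) (Fin.ext hpm)
      rw [h2]
      exact ⟨Or.inl (by simp), h1⟩
    · refine ⟨Or.inr hpm, ?_⟩
      exact rev_notMem_of_not_isSplit (i := ⟨p.2.val, by omega⟩) rfl (h _) hpσ
  · intro p hp q hq hne
    have hpq := hadj p hp q hq hne
    rw [gridGraph2_adj] at hpq ⊢
    rw [gridVertex_ne] at hne ⊢
    simp only [Fin.val_rev]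
    omega

/-! ### The critical faces -/

/-- The critical face of a set `D` of columns other than the last one. Its complement consists of
the columns in `D` and the last vertex of the first row. -/
def criticalFace (D : Finset (Fin m)) : Finset (Fin 2 × Fin (m + 1)) :=
  insert (1, Fin.last m) (Finset.univ ×ˢ Dᶜ.map Fin.castSuccEmb)

theorem mem_criticalFace_castSucc {D : Finset (Fin m)} {r : Fin 2} {j : Fin m} :
    (r, j.castSucc) ∈ criticalFace D ↔ j ∉ D := by
  have : j.castSucc ≠ Fin.last m := (Fin.castSucc_lt_last j).ne
  simp [criticalFace, this]

theorem mem_criticalFace_last {D : Finset (Fin m)} {r : Fin 2} :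
    (r, Fin.last m) ∈ criticalFace D ↔ r = 1 := by
  have : ∀ j : Fin m, j.castSucc ≠ Fin.last m := fun j => (Fin.castSucc_lt_last j).ne
  simp [criticalFace, this]

theorem criticalFace_injective : Function.Injective (criticalFace (m := m)) := by
  intro D D' h
  ext j
  rw [← not_iff_not, ← mem_criticalFace_castSucc (r := 0), h, mem_criticalFace_castSucc]

theorem card_criticalFace (D : Finset (Fin m)) :
    (criticalFace D).card = 2 * (m - D.card) + 1 := by
  have : ∀ j : Fin m, j.castSucc ≠ Fin.last m := fun j => (Fin.castSucc_lt_last j).ne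
  rw [criticalFace, Finset.card_insert_of_notMem (by simp [this]), Finset.card_product,
    Finset.card_map, Finset.card_compl, Finset.card_univ, Fintype.card_fin, Fintype.card_fin]

theorem not_isSplit_criticalFace (D : Finset (Fin m)) (i : Fin m) :
    ¬ IsSplit (criticalFace D) i := by
  simp [IsSplit, mem_criticalFace_castSucc]

theorem criticalFace_iff {k : ℕ} (hk : 1 ≤ k) (σ : Finset (Fin 2 × Fin (m + 1))) :
    (∃ D : Finset (Fin m), D.card = k - 1 ∧ criticalFace D = σ) ↔
      σ ∈ gridCutFaces m k ∧ gridToggle σ ∉ σ ∧ insert (gridToggle σ) σ ∉ gridCutFaces m k := by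
  constructor
  · rintro ⟨D, hD, rfl⟩
    rw [gridToggle_eq_of_not_split (not_isSplit_criticalFace D)]
    refine ⟨?_, by simp [mem_criticalFace_last], ?_⟩
    · -- the parity is such that the last column contributes its vertex in the first row
      refine ⟨_, ?_, isNIndepSet_checkerboard m
        (D := insert (Fin.last m) (D.map Fin.castSuccEmb)) ?_⟩
      · intro p hp
        obtain ⟨c, hc, rfl⟩ := Finset.mem_image.1 hp
        rw [Finset.mem_compl]
        rcases Finset.mem_insert.1 hc with rfl | hc
        · rw [mem_criticalFace_last, checkerRow, Fin.val_last, if_pos (by omega)]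
          decide
        · obtain ⟨j, hj, rfl⟩ := Finset.mem_map.1 hc
          exact fun h => mem_criticalFace_castSucc.1 h hj
      · rw [Finset.card_insert_of_notMem (by simp [(Fin.castSucc_lt_last _).ne]),
          Finset.card_map, hD]
        omega
    · rintro ⟨S, hS, hI⟩
      have := card_le_of_isNIndepSet hI (D := D.map Fin.castSuccEmb) (by
        rintro ⟨r, c⟩ hp
        have hp' := Finset.mem_compl.1 (hS hp)
        rw [Finset.mem_insert, not_or] at hp'
        induction c using Fin.lastCases with
        | last =>
          rw [mem_criticalFace_last] at hp'
          exfalso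
          rcases Fin.exists_fin_two.1 ⟨r, rfl⟩ with h | h <;> subst h <;> simp at hp'
        | cast j =>
          rw [mem_criticalFace_castSucc, not_not] at hp'
          simpa using hp'.2)
      rw [Finset.card_map] at this
      omega
  · rintro ⟨hF, hv, hins⟩
    rcases gridToggle_cases σ with ⟨i, r, h1, h2, h3, h4⟩ | ⟨hsplit, h2⟩
    · rw [h4] at hins
      exact absurd (insert_mem_gridCutFaces_of_split h1 h2 h3 hF) hins
    rw [h2] at hv hins
    have hlast : (1, Fin.last m) ∈ σ := by
      by_contra h
      exact hins (insert_mem_gridCutFaces_of_last hsplit h hF)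
    let D : Finset (Fin m) := Finset.univ.filter fun j => (0, j.castSucc) ∉ σ
    have hmem : ∀ (r : Fin 2) (j : Fin m), (r, j.castSucc) ∈ σ ↔ j ∉ D := by
      intro r j
      have h0 : (0, j.castSucc) ∈ σ ↔ j ∉ D := by simp [D]
      rcases Fin.exists_fin_two.1 ⟨r, rfl⟩ with h | h <;> subst h
      · exact h0
      · exact (not_not.1 (hsplit j)).symm.trans h0
    refine ⟨D, le_antisymm ?_ ?_, ?_⟩
    · -- otherwise the columns in `D` contain an independent set of size `k`
      by_contra hlt
      obtain ⟨D', hD', hcard⟩ := Finset.exists_subset_card_eq (s := D) (n := k) (by omega)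
      refine hins ⟨_, ?_, isNIndepSet_checkerboard 0 (D := D'.map Fin.castSuccEmb)
        (by rw [Finset.card_map, hcard])⟩
      intro p hp
      obtain ⟨c, hc, rfl⟩ := Finset.mem_image.1 hp
      obtain ⟨j, hj, rfl⟩ := Finset.mem_map.1 hc
      rw [Finset.mem_compl, Finset.mem_insert, not_or]
      exact ⟨fun h => (Fin.castSucc_lt_last j).ne (congrArg Prod.snd h),
        fun h => (hmem _ j).1 h (hD' hj)⟩
    · obtain ⟨S, hS, hI⟩ := hF
      have h := card_le_of_isNIndepSet hI (D := insert (Fin.last m) (D.map Fin.castSuccEmb)) (by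
        rintro ⟨r, c⟩ hp
        have hp' := Finset.mem_compl.1 (hS hp)
        induction c using Fin.lastCases with
        | last => exact Finset.mem_insert_self _ _
        | cast j =>
          rw [hmem, not_not] at hp'
          exact Finset.mem_insert_of_mem (Finset.mem_map_of_mem _ hp'))
      have h' := Finset.card_insert_le (Fin.last m) (D.map Fin.castSuccEmb)
      rw [Finset.card_map] at h'
      omega
    · ext ⟨r, c⟩
      induction c using Fin.lastCases with
      | last =>
        rw [mem_criticalFace_last]
        rcases Fin.exists_fin_two.1 ⟨r, rfl⟩ with h | h <;> subst h
        · simpa using hv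
        · simpa using hlast
      | cast j => rw [mem_criticalFace_castSucc, hmem]

theorem singleton_gridToggle_empty_mem {k : ℕ} (hk : k ≤ m + 1) :
    {gridToggle ∅} ∈ gridCutFaces m k := by
  rw [gridToggle_eq_of_not_split (by simp [IsSplit])]
  obtain ⟨D, -, hD⟩ := Finset.exists_subset_card_eq (s := (Finset.univ : Finset (Fin (m + 1))))
    (n := k) (by simpa using hk)
  -- the parity is such that the last column contributes its vertex in the second row
  refine ⟨_, fun p hp => ?_, isNIndepSet_checkerboard (m + 1) hD⟩
  obtain ⟨c, -, rfl⟩ := Finset.mem_image.1 hp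
  rw [Finset.mem_compl, Finset.mem_singleton]
  intro h
  obtain ⟨h1, rfl⟩ := Prod.mk.inj h
  rw [checkerRow, Fin.val_last, if_neg (by omega)] at h1
  exact one_ne_zero h1

theorem realization_totalCutComplex_gridGraph2 (m k : ℕ) :
    (totalCutComplex (gridGraph2 (m + 1)) k).realization = geomRealization (gridCutFaces m k) := by
  ext x
  refine and_congr_right fun hx => ⟨fun h => h.2, fun h => ⟨?_, h⟩⟩
  by_contra hne
  rw [Finset.not_nonempty_iff_eq_empty, Finset.filter_eq_empty_iff] at hne
  have h0 : ∑ v, x v = 0 := Finset.sum_eq_zero fun v hv => not_not.1 (hne hv)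
  exact zero_ne_one (h0.symm.trans hx.2)

end Grid

theorem theorem3p2 (n k : ℕ) (hk : 2 ≤ k) (hkn : k ≤ n) :
    Nonempty ((totalCutComplex (gridGraph2 n) k).realization ≃ₕ
      WedgeOfSpheres ((n - 1).choose (k - 1)) (2 * n - 2 * k)) := by
  obtain ⟨m, rfl⟩ : ∃ m, n = m + 1 := ⟨n - 1, by omega⟩
  rw [realization_totalCutComplex_gridGraph2]
  let C : Finset (Finset (Fin 2 × Fin (m + 1))) :=
    (Finset.univ.powersetCard (k - 1)).image criticalFace
  have hcard : C.card = (m + 1 - 1).choose (k - 1) := by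
    rw [Finset.card_image_of_injective _ criticalFace_injective, Finset.card_powersetCard,
      Finset.card_univ, Fintype.card_fin, Nat.add_sub_cancel]
  rw [← hcard]
  refine isSequential_gridToggle.nonempty_homotopyEquiv_wedge_of_critical
    (isLowerSet_gridCutFaces m k) (singleton_gridToggle_empty_mem hkn) (fun σ => ?_) ?_
  · rw [← criticalFace_iff (by omega)]
    simp [C, Finset.mem_powersetCard]
  · intro σ hσ
    obtain ⟨D, hD, rfl⟩ := Finset.mem_image.1 hσ
    rw [card_criticalFace, (Finset.mem_powersetCard.1 hD).2]
    omega
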